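/- Let $f:\mathbb R\to\mathbb R$ be $C^\infty$ with $f''(x)\ge\sigma>0$ for all $x\in\mathbb R$. For $\nu>0$ consider solutions $u(t,x)$, $t\ge 0$, $x\in S^1=\mathbb R/\mathbb Z$, of the unforced generalised Burgers equation $$u_t+f'(u)u_x-\nu u_{xx}=0,$$ continuous on $[0,\infty)\times S^1$ and $C^\infty$ on $(0,\infty)\times S^1$, whose initial value $u_0=u(0,\cdot)\not\equiv 0$ is Lipschitz with $\int_{S^1}u_0\,dx=0$. Put $|v|_p=\|v\|_{L_p(S^1)}$, and $$D=\max\big(|u_0|_1^{-1},\ |(u_0)_x|_\infty\big).$$ For $\tilde C>0$ let $T_1=\tfrac14 D^{-2}\tilde C^{-1}$ and $T_2=\max(\tfrac32T_1,\,2D\sigma^{-1})$, and for $p\ge0$, $\ell>0$ put $$S_p(\ell)=\frac1{T_2-T_1}\int_{T_1}^{T_2}\int_{S^1}|u(t,x+\ell)-u(t,x)|^p\,dx\,dt,\qquad F(\ell)=\frac{S_4(\ell)}{S_2(\ell)^2}$$ (with $0^0=1$). For $K>1$ let $\nu_0=\tfrac16K^{-2}$, $C_1=\tfrac14K^{-2}$,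 $C_2=\tfrac1{20}K^{-4}$, so that $0<C_1\nu_0<C_2<1$, and for $\nu\in(0,\nu_0]$ let $J_1=(0,C_1\nu]$ and $J_2=(C_1\nu,C_2]$. Then, for given $f$, $\sigma$ and $D>0$, there are constants $\tilde C>0$ and $K>1$, depending only on $f,\sigma,D$, such that the following holds. First, $|u_x(t)|_2^2\le\tilde C\nu^{-1}$ for all $t\ge0$, for every $\nu\in(0,1]$ and every such solution $u$ with the given $D$. Second, for every $p\ge 0$ there is $C(p)>0$, depending only on $f,\sigma,D,p$, such that for every $\nu\in(0,\nu_0]$ and every such solution $u$ with the given $D$, writing $X\sim_p Y$ for $C(p)^{-1}Y\le X\le C(p)Y$: $$\text{for }\ell\in J_1:\quad S_p(\ell)\sim_p\begin{cases}\ell^p,&0\le p\le1,\\ \ell^p\nu^{-(p-1)},&p\ge1;\end{cases}\qquad \text{for }\ell\in J_2:\quad S_p(\ell)\sim_p\begin{cases}\ell^p,&0\le p\le1,\\ \ell,&p\ge1.\end{cases}$$ Third, there is $C>0$, depending only on $f,\sigma,D$, such that for all these $\nu$ and $u$ and all $\ell\in J_2$, $\ C^{-1}\ell^{-1}\le F(\ell)\le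 C\ell^{-1}$. -/

import Mathlib

open Set MeasureTheory
open scoped ContDiff

noncomputable section

/-- The homogeneous norm `|v|_{m,p}`, i.e. the `L_p` norm over one period of the `m`-th derivative.
Functions on the circle `ℝ/ℤ` are `1`-periodic functions on `ℝ`.  For a Lipschitz `v` and `m = 1`
the derivative exists almost everywhere and is the weak derivative. -/
def sobolevNorm (m : ℕ) (p : ENNReal) (v : ℝ → ℝ) : ℝ :=
  (eLpNorm (iteratedDeriv m v) p (volume.restrict (Ioc (0 : ℝ) 1))).toReal

/-- The parameter `D = max (|u₀|_1⁻¹, |u₀|_{1,∞})` of an initial condition. -/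
def dataSize (u₀ : ℝ → ℝ) : ℝ :=
  max (sobolevNorm 0 1 u₀)⁻¹ (sobolevNorm 1 ⊤ u₀)

/-- `u t x` is a solution, for `t ≥ 0`, of the unforced equation
`u_t + f'(u) u_x - ν u_xx = 0` on the circle, with zero mean and an initial value in `W^{1,∞}`
(that is, Lipschitz).  It is smooth for positive times and attains its initial value
continuously. -/
structure IsBurgersSolution (f : ℝ → ℝ) (ν : ℝ) (u : ℝ → ℝ → ℝ) : Prop where
  periodic : ∀ t : ℝ, 0 ≤ t → Function.Periodic (u t) 1
  continuousOn : ContinuousOn (fun z : ℝ × ℝ => u z.1 z.2) (Ici (0 : ℝ) ×ˢ univ)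
  contDiffOn : ContDiffOn ℝ ∞ (fun z : ℝ × ℝ => u z.1 z.2) (Ioi (0 : ℝ) ×ˢ univ)
  equation : ∀ t : ℝ, 0 < t → ∀ x : ℝ,
    deriv (fun s : ℝ => u s x) t + deriv f (u t x) * deriv (u t) x
      - ν * iteratedDeriv 2 (u t) x = 0
  lipschitz_initial : ∃ L : NNReal, LipschitzWith L (u 0)
  mean_zero_initial : ∫ x in (0 : ℝ)..1, u 0 x = 0

/-- `T₁ = (1/4) D⁻² C⁻¹`. -/
def timeOne (D C : ℝ) : ℝ := 1 / (4 * D ^ 2 * C)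

/-- `T₂ = max ((3/2) T₁, 2 D σ⁻¹)`. -/
def timeTwo (σ D C : ℝ) : ℝ := max (3 / 2 * timeOne D C) (2 * D / σ)

/-- The average of `A` over the time interval `[T₁, T₂]`. -/
def timeAverage (T₁ T₂ : ℝ) (A : ℝ → ℝ) : ℝ :=
  1 / (T₂ - T₁) * ∫ t in T₁..T₂, A t

/-- The time-averaged structure function of order `p`. -/
def structureFunction (T₁ T₂ : ℝ) (u : ℝ → ℝ → ℝ) (p ℓ : ℝ) : ℝ :=
  timeAverage T₁ T₂ fun t => ∫ x in (0 : ℝ)..1, |u t (x + ℓ) - u t x| ^ p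

/-- The flatness `F(ℓ) = S₄(ℓ) / S₂(ℓ)²`. -/
def flatness (T₁ T₂ : ℝ) (u : ℝ → ℝ → ℝ) (ℓ : ℝ) : ℝ :=
  structureFunction T₁ T₂ u 4 ℓ / structureFunction T₁ T₂ u 2 ℓ ^ 2

/-- The largest viscosity `ν₀ = K⁻² / 6`. -/
def viscosityBound (K : ℝ) : ℝ := 1 / (6 * K ^ 2)

/-- The dissipation range `J₁ = (0, C₁ ν]`, with `C₁ = K⁻² / 4`. -/
def dissipationRange (K ν : ℝ) : Set ℝ := Ioc 0 (1 / (4 * K ^ 2) * ν)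

/-- The inertial range `J₂ = (C₁ ν, C₂]`, with `C₁ = K⁻² / 4` and `C₂ = K⁻⁴ / 20`. -/
def inertialRange (K ν : ℝ) : Set ℝ := Ioc (1 / (4 * K ^ 2) * ν) (1 / (20 * K ^ 4))

/-- `X ∼ Y` with the constant `C`. -/
def Comparable (C X Y : ℝ) : Prop := C⁻¹ * Y ≤ X ∧ X ≤ C * Y

end

/-! ### One-variable calculus -/

/-! A solution consists of ramps whose slope is bounded above independently of `ν`, broken by cliffs
of width of order `ν`. Three facts uniform in `ν` make this precise: `u_x ≤ D`, `|u_x| ≤ B / ν`, and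
a lower bound for the dissipation `ν ∫∫ u_x²` on `[T₁, T₂]`.

The two gradient bounds come from `two_point_comparison`, a maximum principle for `u(t, y + h) -
u(t, y)` against a barrier in `h`. Increments are used instead of `u_x` because they are continuous
up to `t = 0`, where the datum is only Lipschitz. A linear barrier with slope solving `a' = -σ a²`
gives the one-sided bound and the decay of `|u|`; a steep concave barrier gives `u_x ≥ -B / ν`.

Since `u_x` has mean zero and is at most `D`, `∫ |u_x| ≤ 2D`, hence `∫ u_x² ≤ Ct / ν`. The energy `∫
u²` is therefore still at least `1 / (2D²)` at `T₁`, while the decay pushes it below `1 / (4D²)` at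
`T₂`; the difference has been dissipated (`inv_le_dissipation`). An `H¹` estimate bounds the
averaged `∫ u_xx²` by a multiple of `ν⁻³`.

For the structure functions, `S₁(ℓ) ≤ 2Dℓ` always. If moreover the increments are bounded by `Λ` and
`S₂(ℓ) ≥ c ℓ Λ`, pointwise inequalities between powers give `S_p ∼ ℓ Λ^(p-1)` for `p ≥ 1` and `S_p ∼
ℓ^p` for `p ≤ 1`; this is what `IncrementControl` packages. In the dissipation range `Λ = Bℓ / ν`,
and `S₂` is bounded below by Taylor expansion. In the inertial range `Λ = 2D`, and the bound is
transported from a scale `ℓ₀` of order `ν`: a drop across `ℓ₀` cannot be undone over a longer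
interval, because upward increments are at most `Dℓ` (`cliff_le_incrementMoment_two`). The flatness
estimate is the case of `p = 2` and `p = 4`. -/

/-- With a positive second derivative the point would be a local minimum too, so `q` would be
locally constant. -/
theorem IsLocalMax.deriv_deriv_nonpos {q : ℝ → ℝ} {a : ℝ} (hq : IsLocalMax q a)
    (hc : ContinuousAt q a) : deriv (deriv q) a ≤ 0 := by
  by_contra! h
  have hmin := isLocalMin_of_deriv_deriv_pos h hq.deriv_eq_zero hc
  have hconst : q =ᶠ[nhds a] fun _ => q a := by
    filter_upwards [hq, hmin] with x h1 h2 using le_antisymm h1 h2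
  have h1 : deriv q =ᶠ[nhds a] fun _ => 0 := by
    have := hconst.deriv
    simpa using this
  rw [h1.deriv_eq] at h
  simp at h

theorem deriv_nonneg_of_forall_le {q : ℝ → ℝ} {a b q' : ℝ} (hba : b < a)
    (hq : HasDerivAt q q' a) (hle : ∀ s ∈ Icc b a, q s ≤ q a) : 0 ≤ q' := by
  have h1 := hq.hasDerivWithinAt (s := Iio a)
  rw [hasDerivWithinAt_iff_tendsto_slope' (by simp)] at h1
  refine ge_of_tendsto h1 ?_
  have : Ioo b a ∈ nhdsWithin a (Iio a) := Ioo_mem_nhdsLT hba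
  filter_upwards [this] with s hs
  rw [slope_def_field]
  exact div_nonneg_of_nonpos (by linarith [hle s ⟨hs.1.le, hs.2.le⟩]) (by linarith [hs.2])

/-- Cauchy–Schwarz, obtained from the nonnegativity of the variance of `g`. -/
theorem sq_integral_le {g : ℝ → ℝ} {a b : ℝ} (hab : a ≤ b) (hg : ContinuousOn g (Icc a b)) :
    (∫ x in a..b, g x) ^ 2 ≤ (b - a) * ∫ x in a..b, g x ^ 2 := by
  rcases hab.eq_or_lt with rfl | hlt
  · simp
  have hg' : ContinuousOn g (uIcc a b) := by rwa [uIcc_of_le hab]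
  set m := (∫ x in a..b, g x) / (b - a) with hm
  have h0 : 0 ≤ ∫ x in a..b, (g x - m) ^ 2 :=
    intervalIntegral.integral_nonneg hab fun x _ => sq_nonneg _
  have hi1 : IntervalIntegrable (fun x => g x ^ 2) volume a b := (hg'.pow 2).intervalIntegrable
  have hi2 : IntervalIntegrable (fun x => 2 * m * g x) volume a b :=
    (hg'.const_mul (2 * m)).intervalIntegrable
  have h1 : ∫ x in a..b, (g x - m) ^ 2
      = (∫ x in a..b, g x ^ 2) - 2 * m * (∫ x in a..b, g x) + (b - a) * m ^ 2 := by
    have : (fun x => (g x - m) ^ 2) = fun x => g x ^ 2 - 2 * m * g x + m ^ 2 := by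
      ext x; ring
    rw [this, intervalIntegral.integral_add (hi1.sub hi2) (by simp),
      intervalIntegral.integral_sub hi1 hi2, intervalIntegral.integral_const_mul]
    simp
  have hpos : 0 < b - a := by linarith
  have h2 : (∫ x in a..b, g x) = m * (b - a) := by rw [hm]; field_simp
  rw [h1, h2] at h0
  rw [h2]
  nlinarith [mul_nonneg hpos.le h0]

theorem continuousOn_intervalIntegral {g : ℝ → ℝ → ℝ} {s : Set ℝ} (a b : ℝ)
    (hg : ContinuousOn (fun z : ℝ × ℝ => g z.1 z.2) (s ×ˢ univ)) :
    ContinuousOn (fun t => ∫ x in a..b, g t x) s := by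
  rw [continuousOn_iff_continuous_domRestrict]
  have : Continuous (Function.uncurry fun (t : s) (x : ℝ) => g t x) := by
    have h := hg.comp_continuous (f := fun z : s × ℝ => ((z.1 : ℝ), z.2)) (by fun_prop)
      (fun z => by simp)
    exact h
  exact intervalIntegral.continuous_parametric_intervalIntegral_of_continuous' this a b

theorem ContinuousOn.slice {g : ℝ → ℝ → ℝ} {s : Set ℝ}
    (hg : ContinuousOn (fun z : ℝ × ℝ => g z.1 z.2) (s ×ˢ univ)) {t : ℝ} (ht : t ∈ s) :
    Continuous (g t) :=
  hg.comp_continuous (f := fun x => (t, x)) (by fun_prop) fun x => by simp [ht]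

theorem ContinuousOn.slice_left {g : ℝ → ℝ → ℝ} {s : Set ℝ}
    (hg : ContinuousOn (fun z : ℝ × ℝ => g z.1 z.2) (s ×ˢ univ)) (x : ℝ) :
    ContinuousOn (fun t => g t x) s :=
  hg.comp (f := fun t => (t, x)) (by fun_prop) fun t ht => by simp [ht]

theorem intervalIntegral_swap_of_continuousOn {g : ℝ → ℝ → ℝ} {a b c d : ℝ} (hab : a ≤ b)
    (hcd : c ≤ d) (hg : ContinuousOn (fun z : ℝ × ℝ => g z.1 z.2) (Icc a b ×ˢ Icc c d)) :
    ∫ t in a..b, ∫ x in c..d, g t x = ∫ x in c..d, ∫ t in a..b, g t x := by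
  simp_rw [intervalIntegral.integral_of_le hab, intervalIntegral.integral_of_le hcd]
  refine integral_integral_swap ?_
  rw [Measure.prod_restrict]
  exact (hg.integrableOn_compact (isCompact_Icc.prod isCompact_Icc)).mono_set
    (prod_mono Ioc_subset_Icc_self Ioc_subset_Icc_self)

/-- Integrated form of differentiation under the integral sign. -/
theorem integral_sub_integral_eq {g g' : ℝ → ℝ → ℝ} {a b : ℝ} (hab : a ≤ b)
    (hg : ContinuousOn (fun z : ℝ × ℝ => g z.1 z.2) (Icc a b ×ˢ univ))
    (hg' : ContinuousOn (fun z : ℝ × ℝ => g' z.1 z.2) (Icc a b ×ˢ univ))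
    (hd : ∀ t ∈ Icc a b, ∀ x, HasDerivAt (fun s => g s x) (g' t x) t) :
    (∫ x in (0 : ℝ)..1, g b x) - ∫ x in (0 : ℝ)..1, g a x
      = ∫ t in a..b, ∫ x in (0 : ℝ)..1, g' t x := by
  rw [intervalIntegral_swap_of_continuousOn hab zero_le_one
    (hg'.mono (prod_mono le_rfl (subset_univ _))),
    ← intervalIntegral.integral_sub
      ((hg.slice (right_mem_Icc.2 hab)).intervalIntegrable _ _)
      ((hg.slice (left_mem_Icc.2 hab)).intervalIntegrable _ _)]
  refine intervalIntegral.integral_congr fun x _ => ?_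
  symm
  refine intervalIntegral.integral_eq_sub_of_hasDerivAt (f := fun s => g s x) (fun t ht => ?_) ?_
  · rw [uIcc_of_le hab] at ht
    exact hd t ht x
  · refine ContinuousOn.intervalIntegrable ?_
    rw [uIcc_of_le hab]
    exact hg'.slice_left x

/-! ### Periodic functions -/

theorem Function.Periodic.deriv_periodic {v : ℝ → ℝ} (hv : Function.Periodic v 1) :
    Function.Periodic (deriv v) 1 := fun x => by
  rw [← deriv_comp_add_const]
  congr 1
  ext y
  exact hv y

theorem Function.Periodic.integral_deriv_eq_zero {v v' : ℝ → ℝ} (hv : Function.Periodic v 1)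
    (hd : ∀ x, HasDerivAt v (v' x) x) (hc : Continuous v') :
    ∫ x in (0 : ℝ)..1, v' x = 0 := by
  rw [intervalIntegral.integral_eq_sub_of_hasDerivAt (fun x _ => hd x)
    (hc.intervalIntegrable _ _)]
  have := hv 0
  simp only [zero_add] at this
  simp [this]

theorem Function.Periodic.integral_shift {v : ℝ → ℝ} (hv : Function.Periodic v 1) (c : ℝ) :
    ∫ x in (0 : ℝ)..1, v (x + c) = ∫ x in (0 : ℝ)..1, v x := by
  rw [intervalIntegral.integral_comp_add_right]
  have := hv.intervalIntegral_add_eq c 0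
  rw [zero_add] at this
  rw [← this]
  congr 1 <;> ring

/-- The mean being zero, `|w|` may be replaced by `|w| + w`, which is twice the positive part of
`w`. -/
theorem integral_abs_le_of_integral_eq_zero {w : ℝ → ℝ} (hw : Continuous w)
    (h0 : ∫ x in (0 : ℝ)..1, w x = 0) {m : ℝ} (hm : 0 ≤ m) (hle : ∀ x, w x ≤ m) :
    ∫ x in (0 : ℝ)..1, |w x| ≤ 2 * m := by
  have h1 : ∫ x in (0 : ℝ)..1, |w x| = ∫ x in (0 : ℝ)..1, (|w x| + w x) := by
    rw [intervalIntegral.integral_add (hw.abs.intervalIntegrable _ _)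
      (hw.intervalIntegrable _ _), h0, add_zero]
  rw [h1]
  have h2 : ∫ x in (0 : ℝ)..1, (|w x| + w x) ≤ ∫ x in (0 : ℝ)..1, 2 * m := by
    refine intervalIntegral.integral_mono_on zero_le_one
      ((hw.abs.add hw).intervalIntegrable _ _) (by simp) fun x _ => ?_
    rcases abs_cases (w x) with h | h <;> linarith [hle x]
  simpa using h2

theorem exists_eq_zero_of_integral_eq_zero {v : ℝ → ℝ} (hv : Continuous v)
    (h0 : ∫ x in (0 : ℝ)..1, v x = 0) : ∃ z, v z = 0 := by
  by_contra! h
  have hcase : (∀ x, 0 < v x) ∨ (∀ x, v x < 0) := by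
    by_contra! hc
    obtain ⟨⟨x, hx⟩, y, hy⟩ := hc
    obtain ⟨z, hz⟩ := mem_range_of_exists_le_of_exists_ge hv ⟨x, hx⟩ ⟨y, hy⟩
    exact h z hz
  rcases hcase with hp | hn
  · have := intervalIntegral.intervalIntegral_pos_of_pos_on (hv.intervalIntegrable 0 1)
      (fun x _ => hp x) zero_lt_one
    linarith
  · have := intervalIntegral.intervalIntegral_pos_of_pos_on (hv.neg.intervalIntegrable 0 1)
      (fun x _ => neg_pos.2 (hn x)) zero_lt_one
    simp only [Pi.neg_apply, intervalIntegral.integral_neg] at this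
    linarith

/-- A periodic function with a zero that satisfies a one-sided Lipschitz bound is bounded. -/
theorem Function.Periodic.abs_le_of_one_sided {v : ℝ → ℝ} (hv : Function.Periodic v 1) {m : ℝ}
    (hm : 0 ≤ m) (hle : ∀ x, ∀ h ∈ Icc (0 : ℝ) 1, v (x + h) - v x ≤ m * h) {z : ℝ}
    (hz : v z = 0) (x : ℝ) : |v x| ≤ m := by
  have key : ∀ h ∈ Icc (0 : ℝ) 1, m * h ≤ m := fun h hh => by nlinarith [hh.1, hh.2]
  have hfl : 0 ≤ Int.fract (x - z) := Int.fract_nonneg _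
  have hlt : Int.fract (x - z) < 1 := Int.fract_lt_one _
  have e1 : v (z + Int.fract (x - z)) = v x := by
    have : z + Int.fract (x - z) = x - (⌊x - z⌋ : ℤ) * 1 := by
      rw [Int.fract]; ring
    rw [this, hv.sub_int_mul_eq]
  -- The upper bound for `v x` climbs from the zero `z` to `x`; the lower bound climbs from `x` to
  -- the next zero `z + 1`.
  have h1 := hle z _ ⟨hfl, hlt.le⟩
  have h2 := hle (z + Int.fract (x - z)) (1 - Int.fract (x - z)) ⟨by linarith, by linarith⟩
  have e2 : v (z + Int.fract (x - z) + (1 - Int.fract (x - z))) = 0 := by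
    rw [← hz, ← hv z]; congr 1; ring
  have k1 := key _ ⟨hfl, hlt.le⟩
  have k2 := key (1 - Int.fract (x - z)) ⟨by linarith, by linarith⟩
  rw [e2, e1] at h2
  rw [e1, hz] at h1
  exact abs_le.2 ⟨by linarith, by linarith⟩

/-! ### Partial derivatives of functions of time and space -/

/-- `g` is smooth, jointly in time and space, for positive times. -/
def SmoothForPos (g : ℝ → ℝ → ℝ) : Prop :=
  ContDiffOn ℝ ∞ (fun z : ℝ × ℝ => g z.1 z.2) (Ioi (0 : ℝ) ×ˢ univ)

theorem isOpen_posTimes : IsOpen (Ioi (0 : ℝ) ×ˢ (univ : Set ℝ)) := isOpen_Ioi.prod isOpen_univ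

namespace SmoothForPos

variable {g : ℝ → ℝ → ℝ} {t : ℝ}

theorem continuousOn (hg : SmoothForPos g) :
    ContinuousOn (fun z : ℝ × ℝ => g z.1 z.2) (Ioi (0 : ℝ) ×ˢ univ) :=
  ContDiffOn.continuousOn hg

theorem contDiffAt (hg : SmoothForPos g) (ht : 0 < t) (x : ℝ) :
    ContDiffAt ℝ ∞ (fun z : ℝ × ℝ => g z.1 z.2) (t, x) :=
  ContDiffOn.contDiffAt hg (isOpen_posTimes.mem_nhds (by simp [ht]))

theorem hasFDerivAt (hg : SmoothForPos g) (ht : 0 < t) (x : ℝ) :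
    HasFDerivAt (fun z : ℝ × ℝ => g z.1 z.2)
      (fderiv ℝ (fun z : ℝ × ℝ => g z.1 z.2) (t, x)) (t, x) :=
  ((hg.contDiffAt ht x).differentiableAt (by simp)).hasFDerivAt

theorem hasDerivAt_space' (hg : SmoothForPos g) (ht : 0 < t) (x : ℝ) :
    HasDerivAt (g t) (fderiv ℝ (fun z : ℝ × ℝ => g z.1 z.2) (t, x) (0, 1)) x := by
  have h := (hg.hasFDerivAt ht x).comp_hasDerivAt (f := fun y : ℝ => (t, y)) x
    ((hasDerivAt_const x t).prodMk (hasDerivAt_id x))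
  exact h

theorem hasDerivAt_time' (hg : SmoothForPos g) (ht : 0 < t) (x : ℝ) :
    HasDerivAt (fun s => g s x) (fderiv ℝ (fun z : ℝ × ℝ => g z.1 z.2) (t, x) (1, 0)) t := by
  have h := (hg.hasFDerivAt ht x).comp_hasDerivAt (f := fun s : ℝ => (s, x)) t
    ((hasDerivAt_id t).prodMk (hasDerivAt_const t x))
  exact h

theorem hasDerivAt_space (hg : SmoothForPos g) (ht : 0 < t) (x : ℝ) :
    HasDerivAt (g t) (deriv (g t) x) x :=
  (hg.hasDerivAt_space' ht x).differentiableAt.hasDerivAt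

theorem hasDerivAt_time (hg : SmoothForPos g) (ht : 0 < t) (x : ℝ) :
    HasDerivAt (fun s => g s x) (deriv (fun s => g s x) t) t :=
  (hg.hasDerivAt_time' ht x).differentiableAt.hasDerivAt

theorem contDiffOn_fderiv_apply (hg : SmoothForPos g) (v : ℝ × ℝ) :
    ContDiffOn ℝ ∞ (fun z => fderiv ℝ (fun z : ℝ × ℝ => g z.1 z.2) z v)
      (Ioi (0 : ℝ) ×ˢ univ) :=
  (ContDiffOn.fderiv_of_isOpen (m := ∞) hg isOpen_posTimes (by simp)).clm_apply contDiffOn_const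

theorem deriv_space (hg : SmoothForPos g) : SmoothForPos fun t x => deriv (g t) x :=
  (hg.contDiffOn_fderiv_apply (0, 1)).congr fun z hz => (hg.hasDerivAt_space' hz.1 z.2).deriv

theorem deriv_time (hg : SmoothForPos g) :
    SmoothForPos fun t x => deriv (fun s => g s x) t :=
  (hg.contDiffOn_fderiv_apply (1, 0)).congr fun z hz => (hg.hasDerivAt_time' hz.1 z.2).deriv

theorem deriv_comm (hg : SmoothForPos g) (ht : 0 < t) (x : ℝ) :
    deriv (fun s => deriv (g s) x) t = deriv (fun y => deriv (fun s => g s y) t) x := by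
  set G : ℝ × ℝ → ℝ := fun z => g z.1 z.2 with hG
  have hd : DifferentiableAt ℝ (fderiv ℝ G) (t, x) :=
    ((hg.contDiffAt ht x).fderiv_right (m := ∞) (by simp)).differentiableAt
      (by simp)
  have hL : HasDerivAt (fun s => fderiv ℝ G (s, x) (0, 1))
      (fderiv ℝ (fderiv ℝ G) (t, x) (1, 0) (0, 1)) t :=
    (hd.hasFDerivAt.comp_hasDerivAt (f := fun s : ℝ => (s, x)) t
      ((hasDerivAt_id t).prodMk (hasDerivAt_const t x))).clm_apply (hasDerivAt_const t (0, 1))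
      |>.congr_deriv (by simp)
  have hR : HasDerivAt (fun y => fderiv ℝ G (t, y) (1, 0))
      (fderiv ℝ (fderiv ℝ G) (t, x) (0, 1) (1, 0)) x :=
    (hd.hasFDerivAt.comp_hasDerivAt (f := fun y : ℝ => (t, y)) x
      ((hasDerivAt_const x t).prodMk (hasDerivAt_id x))).clm_apply (hasDerivAt_const x (1, 0))
      |>.congr_deriv (by simp)
  have e1 : (fun s => deriv (g s) x) =ᶠ[nhds t] fun s => fderiv ℝ G (s, x) (0, 1) := by
    filter_upwards [Ioi_mem_nhds ht] with s hs using (hg.hasDerivAt_space' hs x).deriv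
  have e2 : (fun y => deriv (fun s => g s y) t) = fun y => fderiv ℝ G (t, y) (1, 0) := by
    ext y
    exact (hg.hasDerivAt_time' ht y).deriv
  rw [e1.deriv_eq, hL.deriv, e2, hR.deriv]
  exact (hg.contDiffAt ht x).isSymmSndFDerivAt
    (by simpa using WithTop.coe_le_coe.2 (le_top : (2 : ℕ∞) ≤ ⊤)) _ _

theorem continuous (hg : SmoothForPos g) (ht : 0 < t) : Continuous (g t) :=
  ContinuousOn.slice hg.continuousOn (mem_Ioi.2 ht)

theorem continuousOn_Icc (hg : SmoothForPos g) {a b : ℝ} (ha : 0 < a) :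
    ContinuousOn (fun z : ℝ × ℝ => g z.1 z.2) (Icc a b ×ˢ univ) :=
  hg.continuousOn.mono (prod_mono (fun _ hx => ha.trans_le hx.1) le_rfl)

end SmoothForPos

/-! ### The two-point comparison principle -/

namespace IsBurgersSolution

variable {f : ℝ → ℝ} {ν : ℝ} {u : ℝ → ℝ → ℝ}

theorem smoothForPos (hu : IsBurgersSolution f ν u) : SmoothForPos u := hu.contDiffOn

theorem continuous (hu : IsBurgersSolution f ν u) {t : ℝ} (ht : 0 ≤ t) : Continuous (u t) :=
  ContinuousOn.slice hu.continuousOn (mem_Ici.2 ht)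

theorem deriv_time_eq (hu : IsBurgersSolution f ν u) {t : ℝ} (ht : 0 < t) (x : ℝ) :
    deriv (fun s => u s x) t
      = -(deriv f (u t x) * deriv (u t) x) + ν * deriv (deriv (u t)) x := by
  have h := hu.equation t ht x
  rw [iteratedDeriv_succ, iteratedDeriv_one] at h
  linarith

theorem apply_fract (hu : IsBurgersSolution f ν u) {t : ℝ} (ht : 0 ≤ t) (y h : ℝ) :
    u t (Int.fract y + h) = u t (y + h) := by
  have : Int.fract y + h = y + h - (⌊y⌋ : ℤ) * 1 := by rw [Int.fract]; ring
  rw [this, (hu.periodic t ht).sub_int_mul_eq]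

/-- If the barrier is violated, the excess has a positive maximum on a compact set. `hinit`, `hbdry`
and the vanishing of the increment at `h = 0` keep it off the parabolic boundary, and there the
equation contradicts `hpde`. The sign `s = 1` controls upward increments and `s = -1` downward ones;
`c` provides strictness when `b = 0`. -/
theorem two_point_comparison (hu : IsBurgersSolution f ν u) (hν : 0 < ν) (s : ℝ)
    {a a' : ℝ → ℝ} {b c H T : ℝ} (hc : 0 ≤ c)
    (ha : ∀ t ∈ Icc 0 T, HasDerivAt a (a' t) t)
    (hinit : ∀ y, ∀ h ∈ Icc 0 H, s * (u 0 (y + h) - u 0 y) ≤ a 0 * h - b * h ^ 2)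
    (hbdry : ∀ t ∈ Icc 0 T, ∀ y, s * (u t (y + H) - u t y) ≤ a t * H - b * H ^ 2 + c * t)
    (hpde : ∀ t ∈ Ioc 0 T, ∀ h ∈ Ioo 0 H, ∀ y,
      a t * h - b * h ^ 2 + c * t < s * (u t (y + h) - u t y) →
      -(deriv f (u t (y + h)) - deriv f (u t y)) * (a t - 2 * b * h) - 8 * ν * b
        < a' t * h + c) :
    ∀ t ∈ Icc 0 T, ∀ h ∈ Icc 0 H, ∀ y,
      s * (u t (y + h) - u t y) ≤ a t * h - b * h ^ 2 + c * t := by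
  intro t₀ ht₀ h₀ hh₀ y₀
  set Φ : ℝ → ℝ → ℝ → ℝ := fun t h y =>
    s * (u t (y + h) - u t y) - (a t * h - b * h ^ 2 + c * t) with hΦ
  by_contra! hcon
  have hcont : ContinuousOn (fun z : ℝ × ℝ × ℝ => Φ z.1 z.2.1 z.2.2)
      (Icc 0 T ×ˢ Icc 0 H ×ˢ Icc (0 : ℝ) 1) := by
    have hac : ContinuousOn a (Icc 0 T) := fun t ht => (ha t ht).continuousAt.continuousWithinAt
    have hac' : ContinuousOn (fun z : ℝ × ℝ × ℝ => a z.1)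
        (Icc 0 T ×ˢ Icc 0 H ×ˢ Icc (0 : ℝ) 1) :=
      hac.comp continuousOn_fst fun z hz => hz.1
    have h1 : ContinuousOn (fun z : ℝ × ℝ × ℝ => u z.1 (z.2.2 + z.2.1))
        (Icc 0 T ×ˢ Icc 0 H ×ˢ Icc (0 : ℝ) 1) :=
      hu.continuousOn.comp (f := fun z : ℝ × ℝ × ℝ => (z.1, z.2.2 + z.2.1))
        (by fun_prop) fun z hz => ⟨hz.1.1, mem_univ _⟩
    have h2 : ContinuousOn (fun z : ℝ × ℝ × ℝ => u z.1 z.2.2)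
        (Icc 0 T ×ˢ Icc 0 H ×ˢ Icc (0 : ℝ) 1) :=
      hu.continuousOn.comp (f := fun z : ℝ × ℝ × ℝ => (z.1, z.2.2))
        (by fun_prop) fun z hz => ⟨hz.1.1, mem_univ _⟩
    exact (continuousOn_const.mul (h1.sub h2)).sub
      (((hac'.mul (by fun_prop)).sub (by fun_prop)).add (by fun_prop))
  have hfract : ∀ y : ℝ, Int.fract y ∈ Icc (0 : ℝ) 1 := fun y =>
    ⟨Int.fract_nonneg y, (Int.fract_lt_one y).le⟩
  -- Periodicity restricts `y` to one period, so that the maximum is attained.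
  have hΦfract : ∀ t ∈ Icc 0 T, ∀ h y, Φ t h (Int.fract y) = Φ t h y := fun t ht h y => by
    have e1 := hu.apply_fract ht.1 y h
    have e2 := hu.apply_fract ht.1 y 0
    simp only [add_zero] at e2
    simp only [hΦ, e1, e2]
  obtain ⟨⟨t, h, y⟩, ⟨ht, hh, -⟩, hmax⟩ := (isCompact_Icc.prod
    (isCompact_Icc.prod isCompact_Icc)).exists_isMaxOn
      ⟨(t₀, h₀, Int.fract y₀), ht₀, hh₀, hfract y₀⟩ hcont
  simp only at ht hh
  have hglob : ∀ t' ∈ Icc 0 T, ∀ h' ∈ Icc 0 H, ∀ y', Φ t' h' y' ≤ Φ t h y := by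
    intro t' ht' h' hh' y'
    rw [← hΦfract t' ht']
    exact hmax (show (t', h', Int.fract y') ∈ _ from ⟨ht', hh', hfract y'⟩)
  have hpos : 0 < Φ t h y := lt_of_lt_of_le (sub_pos.2 hcon) (hglob t₀ ht₀ h₀ hh₀ y₀)
  have hpos' := sub_pos.1 hpos
  have htpos : 0 < t := by
    refine lt_of_le_of_ne ht.1 fun h0 => ?_
    have := hinit y h hh
    rw [← h0] at hpos'
    linarith
  have hhpos : 0 < h := by
    refine lt_of_le_of_ne hh.1 fun h0 => ?_
    rw [← h0] at hpos'
    simp only [add_zero, sub_self, mul_zero] at hpos'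
    nlinarith
  have hhH : h < H := by
    refine lt_of_le_of_ne hh.2 fun h0 => ?_
    have := hbdry t ht y
    rw [h0] at hpos'
    linarith
  have hsm := hu.smoothForPos
  have hd1 := fun x => hsm.hasDerivAt_space htpos x
  have hd2 := fun x => hsm.deriv_space.hasDerivAt_space htpos x
  -- first-order conditions
  have hx : s * deriv (u t) (y + h) = a t - 2 * b * h := by
    have hloc : IsLocalMax (fun x => s * (u t x - u t y)
        - (a t * (x - y) - b * (x - y) ^ 2 + c * t)) (y + h) := by
      have : Ioo y (y + H) ∈ nhds (y + h) := Ioo_mem_nhds (by linarith) (by linarith)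
      filter_upwards [this] with x hx
      have := hglob t ht (x - y) ⟨by linarith [hx.1], by linarith [hx.2]⟩ y
      simpa [hΦ] using this
    have hder : HasDerivAt (fun x => s * (u t x - u t y)
        - (a t * (x - y) - b * (x - y) ^ 2 + c * t))
        (s * deriv (u t) (y + h) - (a t - 2 * b * h)) (y + h) := by
      have hl : HasDerivAt (fun x : ℝ => x - y) 1 (y + h) := (hasDerivAt_id _).sub_const y
      refine ((((hd1 (y + h)).sub_const (u t y)).const_mul s).sub
        (((hl.const_mul (a t)).sub ((hl.pow 2).const_mul b)).add_const (c * t))).congr_deriv ?_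
      simp
      ring
    linarith [hloc.hasDerivAt_eq_zero hder]
  have hy : s * deriv (u t) y = a t - 2 * b * h := by
    have hloc : IsLocalMax (fun r => s * (u t (y + h) - u t r)
        - (a t * (y + h - r) - b * (y + h - r) ^ 2 + c * t)) y := by
      have : Ioo (y + h - H) (y + h) ∈ nhds y := Ioo_mem_nhds (by linarith) (by linarith)
      filter_upwards [this] with r hr
      have := hglob t ht (y + h - r) ⟨by linarith [hr.2], by linarith [hr.1]⟩ r
      simpa [hΦ] using this
    have hder : HasDerivAt (fun r => s * (u t (y + h) - u t r)
        - (a t * (y + h - r) - b * (y + h - r) ^ 2 + c * t))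
        (-(s * deriv (u t) y) + (a t - 2 * b * h)) y := by
      have hl : HasDerivAt (fun r : ℝ => y + h - r) (-1) y := (hasDerivAt_id _).const_sub (y + h)
      refine ((((hd1 y).const_sub (u t (y + h))).const_mul s).sub
        (((hl.const_mul (a t)).sub ((hl.pow 2).const_mul b)).add_const (c * t))).congr_deriv ?_
      simp
      ring
    linarith [hloc.hasDerivAt_eq_zero hder]
  -- second-order condition
  have hxx : s * (deriv (deriv (u t)) (y + h) - deriv (deriv (u t)) y) ≤ -(8 * b) := by
    set q : ℝ → ℝ := fun r => s * (u t (y + h + r) - u t (y - r))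
      - (a t * (h + 2 * r) - b * (h + 2 * r) ^ 2 + c * t) with hq
    have hloc : IsLocalMax q 0 := by
      have : Ioo (-(h / 2)) ((H - h) / 2) ∈ nhds (0 : ℝ) :=
        Ioo_mem_nhds (by linarith) (by linarith)
      filter_upwards [this] with r hr
      have := hglob t ht (h + 2 * r) ⟨by linarith [hr.1], by linarith [hr.2]⟩ (y - r)
      have e : y - r + (h + 2 * r) = y + h + r := by ring
      simpa [hΦ, hq, e] using this
    have hplus : ∀ r : ℝ, HasDerivAt (fun r : ℝ => y + h + r) 1 r := fun r =>
      (hasDerivAt_id r).const_add _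
    have hminus : ∀ r : ℝ, HasDerivAt (fun r : ℝ => y - r) (-1) r := fun r =>
      (hasDerivAt_id r).const_sub _
    have hl : ∀ r : ℝ, HasDerivAt (fun r : ℝ => h + 2 * r) 2 r := fun r => by
      simpa using ((hasDerivAt_id r).const_mul 2).const_add h
    have hq1 : ∀ r, HasDerivAt q (s * (deriv (u t) (y + h + r) + deriv (u t) (y - r))
        - (2 * a t - 4 * b * (h + 2 * r))) r := fun r => by
      refine (((((hd1 _).comp r (hplus r)).sub ((hd1 _).comp r (hminus r))).const_mul s).sub
        ((((hl r).const_mul (a t)).sub (((hl r).pow 2).const_mul b)).add_const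
          (c * t))).congr_deriv ?_
      simp
      ring
    have hq2 : HasDerivAt (deriv q)
        (s * (deriv (deriv (u t)) (y + h) - deriv (deriv (u t)) y) + 8 * b) 0 := by
      have e : deriv q = fun r => s * (deriv (u t) (y + h + r) + deriv (u t) (y - r))
          - (2 * a t - 4 * b * (h + 2 * r)) := funext fun r => (hq1 r).deriv
      rw [e]
      refine (((((hd2 _).comp 0 (hplus 0)).add ((hd2 _).comp 0 (hminus 0))).const_mul s).sub
        (((hl 0).const_mul (4 * b)).const_sub (2 * a t))).congr_deriv ?_
      simp
      ring
    have := hloc.deriv_deriv_nonpos (hq1 0).continuousAt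
    rw [hq2.deriv] at this
    linarith
  have htime : a' t * h + c
      ≤ s * (deriv (fun τ => u τ (y + h)) t - deriv (fun τ => u τ y) t) := by
    have hder : HasDerivAt (fun τ => Φ τ h y)
        (s * (deriv (fun τ => u τ (y + h)) t - deriv (fun τ => u τ y) t) - (a' t * h + c)) t := by
      refine ((((hsm.hasDerivAt_time htpos (y + h)).sub
        (hsm.hasDerivAt_time htpos y)).const_mul s).sub
        ((((ha t ht).mul_const h).sub_const (b * h ^ 2)).add
          ((hasDerivAt_id t).const_mul c))).congr_deriv ?_
      simp
    have := deriv_nonneg_of_forall_le htpos hder fun τ hτ =>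
      hglob τ ⟨hτ.1, hτ.2.trans ht.2⟩ h hh y
    linarith
  have hfin := hpde t ⟨htpos, ht.2⟩ h ⟨hhpos, hhH⟩ y hpos'
  rw [hu.deriv_time_eq htpos, hu.deriv_time_eq htpos] at htime
  have e : s * (-(deriv f (u t (y + h)) * deriv (u t) (y + h))
        + ν * deriv (deriv (u t)) (y + h)
        - (-(deriv f (u t y) * deriv (u t) y) + ν * deriv (deriv (u t)) y))
      = -(deriv f (u t (y + h)) * (s * deriv (u t) (y + h))
          - deriv f (u t y) * (s * deriv (u t) y))
        + ν * (s * (deriv (deriv (u t)) (y + h) - deriv (deriv (u t)) y)) := by ring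
  rw [e, hx, hy] at htime
  nlinarith [mul_le_mul_of_nonneg_left hxx hν.le]

end IsBurgersSolution

/-! ### The initial condition -/

/-- The essential supremum is taken over one period; countably many integer translates of the
exceptional null set cover the line. -/
theorem ae_abs_deriv_le_of_dataSize {v : ℝ → ℝ} {L : NNReal} (hL : LipschitzWith L v)
    (hv : Function.Periodic v 1) {D : ℝ} (hD : dataSize v = D) :
    ∀ᵐ x, |deriv v x| ≤ D := by
  set μ := volume.restrict (Ioc (0 : ℝ) 1) with hμ
  have hbd : ∀ x, ‖deriv v x‖ ≤ L := fun x => norm_deriv_le_of_lipschitz hL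
  have hfin : eLpNorm (deriv v) ⊤ μ ≠ ⊤ := by
    have := eLpNorm_le_of_ae_bound (p := ⊤) (μ := μ) (f := deriv v) (Filter.Eventually.of_forall hbd)
    refine ne_top_of_le_ne_top ?_ this
    simp
  have hle : (eLpNorm (deriv v) ⊤ μ).toReal ≤ D := by
    rw [← hD]
    refine le_trans (le_of_eq ?_) (le_max_right _ _)
    rw [sobolevNorm, iteratedDeriv_one]
  have h1 : ∀ᵐ x, x ∈ Ioc (0 : ℝ) 1 → |deriv v x| ≤ D := by
    rw [← ae_restrict_iff' measurableSet_Ioc, ← hμ]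
    have h2 : ∀ᵐ x ∂μ, ‖deriv v x‖ₑ ≤ eLpNorm (deriv v) ⊤ μ := by
      rw [eLpNorm_exponent_top]
      exact ae_le_eLpNormEssSup
    filter_upwards [h2] with x hx
    refine le_trans ?_ hle
    have := ENNReal.toReal_mono hfin hx
    simpa using this
  have h2 : ∀ᵐ x : ℝ, ∀ n : ℤ, x - n ∈ Ioc (0 : ℝ) 1 → |deriv v (x - n)| ≤ D := by
    rw [ae_all_iff]
    intro n
    exact (measurePreserving_sub_right volume (n : ℝ)).quasiMeasurePreserving.ae h1
  filter_upwards [h2] with x hx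
  have h3 := hx (⌈x⌉ - 1) ⟨by push_cast; linarith [Int.ceil_lt_add_one x],
    by push_cast; linarith [Int.le_ceil x]⟩
  have h4 := hv.deriv_periodic.sub_int_mul_eq (x := x) (⌈x⌉ - 1)
  rw [mul_one] at h4
  rwa [h4] at h3

/-- Replaces the unspecified Lipschitz constant `L` by `D`: a Lipschitz function is the integral of
its almost everywhere derivative. -/
theorem abs_sub_le_of_dataSize {v : ℝ → ℝ} {L : NNReal} (hL : LipschitzWith L v)
    (hv : Function.Periodic v 1) {D : ℝ} (hD : dataSize v = D) (x y : ℝ) :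
    |v y - v x| ≤ D * |y - x| := by
  have hac : AbsolutelyContinuousOnInterval v x y :=
    (hL.lipschitzOnWith (s := uIcc x y)).absolutelyContinuousOnInterval
  rw [← hac.integral_deriv_eq_sub]
  rw [← Real.norm_eq_abs]
  refine intervalIntegral.norm_integral_le_of_norm_le_const_ae ?_
  filter_upwards [ae_abs_deriv_le_of_dataSize hL hv hD] with z hz _ using hz

theorem sobolevNorm_zero_one {v : ℝ → ℝ} (hv : Continuous v) :
    sobolevNorm 0 1 v = ∫ x in (0 : ℝ)..1, |v x| := by
  rw [sobolevNorm, iteratedDeriv_zero, eLpNorm_one_eq_lintegral_enorm,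
    intervalIntegral.integral_of_le zero_le_one, ← integral_norm_eq_lintegral_enorm]
  · rfl
  · exact hv.aestronglyMeasurable

theorem inv_le_integral_abs_of_dataSize {v : ℝ → ℝ} (hc : Continuous v)
    (hv : Function.Periodic v 1) {D : ℝ} (hD0 : 0 < D) (hD : dataSize v = D) :
    D⁻¹ ≤ ∫ x in (0 : ℝ)..1, |v x| := by
  have h1 : (∫ x in (0 : ℝ)..1, |v x|)⁻¹ ≤ D := by
    rw [← hD, ← sobolevNorm_zero_one hc]
    exact le_max_left _ _
  have h0 : 0 ≤ ∫ x in (0 : ℝ)..1, |v x| :=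
    intervalIntegral.integral_nonneg zero_le_one fun x _ => abs_nonneg _
  rcases h0.eq_or_lt with h | h
  -- Here `0⁻¹ = 0` makes the first entry of the maximum useless. But then `v` vanishes identically
  -- and `dataSize v = 0`, so `0 < D` is what excludes the zero datum.
  · exfalso
    have hz : ∀ x, v x = 0 := by
      intro x
      by_contra hx
      have hper : Function.Periodic (fun y => |v y|) 1 := fun y => by simp only [hv y]
      have h2 := hper.intervalIntegral_add_eq x 0
      rw [zero_add, ← h] at h2
      have h3 : 0 < ∫ y in x..x + 1, |v y| :=
        intervalIntegral.integral_pos (by linarith) hc.abs.continuousOn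
          (fun y _ => abs_nonneg _) ⟨x, ⟨le_rfl, by linarith⟩, abs_pos.2 hx⟩
      linarith
    have hv0 : v = fun _ => 0 := funext hz
    have : dataSize v = 0 := by
      rw [hv0]
      simp [dataSize, sobolevNorm, iteratedDeriv_one, ← Pi.zero_def]
    linarith
  · exact (inv_le_comm₀ h hD0).1 h1

theorem le_of_hasDerivAt_of_one_sided {q : ℝ → ℝ} {x q' m δ : ℝ} (hδ : 0 < δ)
    (hq : HasDerivAt q q' x) (hle : ∀ h ∈ Icc 0 δ, q (x + h) - q x ≤ m * h) : q' ≤ m := by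
  have h1 := hq.hasDerivWithinAt (s := Ioi x)
  rw [hasDerivWithinAt_iff_tendsto_slope' (by simp)] at h1
  refine le_of_tendsto h1 ?_
  have : Ioo x (x + δ) ∈ nhdsWithin x (Ioi x) := Ioo_mem_nhdsGT (by linarith)
  filter_upwards [this] with s hs
  rw [slope_def_field, div_le_iff₀ (by linarith [hs.1])]
  have := hle (s - x) ⟨by linarith [hs.1], by linarith [hs.2]⟩
  rwa [add_sub_cancel] at this

/-! ### Pointwise bounds on the solution and its gradient -/

theorem mul_sub_le_deriv_sub {f : ℝ → ℝ} (hf : ContDiff ℝ ∞ f) {σ : ℝ}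
    (hconv : ∀ x : ℝ, σ ≤ iteratedDeriv 2 f x) {x y : ℝ} (hxy : x ≤ y) :
    σ * (y - x) ≤ deriv f y - deriv f x := by
  have hd : Differentiable ℝ (deriv f) :=
    ((contDiff_infty_iff_deriv.1 hf).2).differentiable (by simp)
  refine convex_univ.mul_sub_le_image_sub_of_le_deriv hd.continuous.continuousOn
    hd.differentiableOn (fun z _ => ?_) x (mem_univ _) y (mem_univ _) hxy
  have := hconv z
  rwa [iteratedDeriv_succ, iteratedDeriv_one] at this

theorem deriv_sub_le_mul_sub {f : ℝ → ℝ} (hf : ContDiff ℝ ∞ f) {M D : ℝ}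
    (hM : ∀ x ∈ Icc (-D) D, iteratedDeriv 2 f x ≤ M) {x y : ℝ} (hx : |x| ≤ D) (hy : |y| ≤ D)
    (hxy : x ≤ y) : deriv f y - deriv f x ≤ M * (y - x) := by
  have hd : Differentiable ℝ (deriv f) :=
    ((contDiff_infty_iff_deriv.1 hf).2).differentiable (by simp)
  refine (convex_Icc (-D) D).image_sub_le_mul_sub_of_deriv_le hd.continuous.continuousOn
    hd.differentiableOn (fun z hz => ?_) x (abs_le.1 hx) y (abs_le.1 hy) hxy
  have := hM z (interior_subset hz)
  rwa [iteratedDeriv_succ, iteratedDeriv_one] at this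

namespace IsBurgersSolution

variable {f : ℝ → ℝ} {ν σ D : ℝ} {u : ℝ → ℝ → ℝ}

/-- Oleinik's one-sided estimate: convexity turns the nonlinear term into a damping `-σ a²` of the
slope. -/
theorem sub_le_decay_mul (hu : IsBurgersSolution f ν u) (hν : 0 < ν) (hf : ContDiff ℝ ∞ f)
    (hσ : 0 < σ) (hconv : ∀ x : ℝ, σ ≤ iteratedDeriv 2 f x) (hD0 : 0 < D)
    (hD : dataSize (u 0) = D) {t : ℝ} (ht : 0 ≤ t) (y : ℝ) {h : ℝ} (hh : h ∈ Icc (0 : ℝ) 1) :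
    u t (y + h) - u t y ≤ D / (1 + σ * D * t) * h := by
  obtain ⟨L, hL⟩ := hu.lipschitz_initial
  have hden : ∀ τ ∈ Icc 0 t, 0 < 1 + σ * D * τ := fun τ hτ => by
    have := hτ.1
    positivity
  have key : ∀ ε > 0, u t (y + h) - u t y ≤ D / (1 + σ * D * t) * h + ε * t := by
    intro ε hε
    -- The slope solves `a' = -σ a²`, `a 0 = D`. With `H = 1` the boundary condition is periodicity.
    -- As `b = 0`, strictness comes from `c = ε`, which is sent to zero at the end.
    have := hu.two_point_comparison hν 1 (a := fun τ => D / (1 + σ * D * τ))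
      (a' := fun τ => -σ * (D / (1 + σ * D * τ)) ^ 2) (b := 0) (c := ε) (H := 1) (T := t)
      hε.le ?_ ?_ ?_ ?_ t ⟨ht, le_rfl⟩ h hh y
    · simpa using this
    · intro τ hτ
      have h1 : HasDerivAt (fun τ : ℝ => 1 + σ * D * τ) (σ * D) τ := by
        simpa using ((hasDerivAt_id τ).const_mul (σ * D)).const_add 1
      refine ((hasDerivAt_const τ D).div h1 (hden τ hτ).ne').congr_deriv ?_
      have := (hden τ hτ).ne'
      field_simp
      ring
    · intro y h hh
      have := abs_sub_le_of_dataSize hL (hu.periodic 0 le_rfl) hD y (y + h)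
      rw [add_sub_cancel_left, abs_of_nonneg hh.1] at this
      have := (abs_le.1 this).2
      simpa using this
    · intro τ hτ y
      have h1 : u τ (y + 1) = u τ y := hu.periodic τ hτ.1 y
      have h2 : 0 ≤ D / (1 + σ * D * τ) := div_nonneg hD0.le (hden τ hτ).le
      have h3 : 0 ≤ ε * τ := mul_nonneg hε.le hτ.1
      rw [h1]
      simp
      linarith
    · intro τ hτ h hh y hlt
      have ha : 0 < D / (1 + σ * D * τ) := div_pos hD0 (hden τ ⟨hτ.1.le, hτ.2⟩)
      set A := D / (1 + σ * D * τ) with hA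
      have h3 : 0 ≤ ε * τ := mul_nonneg hε.le hτ.1.le
      have h4 : A * h < u τ (y + h) - u τ y := by simp at hlt; linarith
      have h5 : u τ y ≤ u τ (y + h) := by nlinarith [mul_pos ha hh.1]
      have h6 := mul_sub_le_deriv_sub hf hconv h5
      have h7 : σ * (A * h) ≤ deriv f (u τ (y + h)) - deriv f (u τ y) :=
        (mul_le_mul_of_nonneg_left h4.le hσ.le).trans h6
      have h8 := mul_le_mul_of_nonneg_right h7 ha.le
      simp only [mul_zero, zero_mul, sub_zero]
      nlinarith
  refine le_of_forall_pos_le_add fun ε hε => ?_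
  have h1 := key (ε / (t + 1)) (by positivity)
  have h2 : ε / (t + 1) * t ≤ ε := by
    rw [div_mul_eq_mul_div, div_le_iff₀ (by positivity)]
    nlinarith
  linarith

/-- The equation is a conservation law, but only for positive times; the value at `t = 0` is reached
by continuity. -/
theorem integral_eq_zero (hu : IsBurgersSolution f ν u) (hf : ContDiff ℝ ∞ f) {t : ℝ}
    (ht : 0 ≤ t) : ∫ x in (0 : ℝ)..1, u t x = 0 := by
  have hsm := hu.smoothForPos
  have hflux : ∀ τ, 0 < τ → ∫ x in (0 : ℝ)..1, deriv (fun s => u s x) τ = 0 := by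
    intro τ hτ
    have hp := hu.periodic τ hτ.le
    have hp' := hp.deriv_periodic
    refine Function.Periodic.integral_deriv_eq_zero
      (v := fun x => -f (u τ x) + ν * deriv (u τ) x) (fun x => by simp only [hp x, hp' x])
      (fun x => ?_) (hsm.deriv_time.continuous hτ)
    rw [hu.deriv_time_eq hτ]
    have hfd : HasDerivAt f (deriv f (u τ x)) (u τ x) :=
      (hf.differentiable (by simp) _).hasDerivAt
    exact (hfd.comp x (hsm.hasDerivAt_space hτ x)).neg.add
      ((hsm.deriv_space.hasDerivAt_space hτ x).const_mul ν)
  have hconst : ∀ τ ∈ Ioc 0 t, ∫ x in (0 : ℝ)..1, u τ x = ∫ x in (0 : ℝ)..1, u t x := by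
    intro τ hτ
    have := integral_sub_integral_eq hτ.2 (hsm.continuousOn_Icc hτ.1)
      (hsm.deriv_time.continuousOn_Icc hτ.1)
      (fun r hr x => hsm.hasDerivAt_time (hτ.1.trans_le hr.1) x)
    have hzero : ∫ r in τ..t, ∫ x in (0 : ℝ)..1, deriv (fun s => u s x) r = ∫ _ in τ..t, (0 : ℝ) := by
      refine intervalIntegral.integral_congr fun r hr => ?_
      rw [uIcc_of_le hτ.2] at hr
      exact hflux r (hτ.1.trans_le hr.1)
    rw [hzero, intervalIntegral.integral_zero] at this
    linarith
  rcases ht.eq_or_lt with rfl | htpos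
  · exact hu.mean_zero_initial
  have hcont := continuousOn_intervalIntegral 0 1 hu.continuousOn 0 self_mem_Ici
  rw [ContinuousWithinAt, hu.mean_zero_initial] at hcont
  have h1 := hcont.mono_left (nhdsWithin_mono 0 Ioi_subset_Ici_self)
  refine tendsto_nhds_unique (h1.congr' ?_) tendsto_const_nhds |>.symm
  filter_upwards [Ioc_mem_nhdsGT htpos] with τ hτ using hconst τ hτ

/-- Zero mean gives a zero of `u t`, and a periodic function with a zero is bounded by its one-sided
Lipschitz constant. -/
theorem abs_le_decay (hu : IsBurgersSolution f ν u) (hν : 0 < ν) (hf : ContDiff ℝ ∞ f)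
    (hσ : 0 < σ) (hconv : ∀ x : ℝ, σ ≤ iteratedDeriv 2 f x) (hD0 : 0 < D)
    (hD : dataSize (u 0) = D) {t : ℝ} (ht : 0 ≤ t) (x : ℝ) :
    |u t x| ≤ D / (1 + σ * D * t) := by
  obtain ⟨z, hz⟩ := exists_eq_zero_of_integral_eq_zero (hu.continuous ht)
    (hu.integral_eq_zero hf ht)
  exact (hu.periodic t ht).abs_le_of_one_sided (by positivity)
    (fun x h hh => hu.sub_le_decay_mul hν hf hσ hconv hD0 hD ht x hh) hz x

theorem abs_le_dataSize (hu : IsBurgersSolution f ν u) (hν : 0 < ν) (hf : ContDiff ℝ ∞ f)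
    (hσ : 0 < σ) (hconv : ∀ x : ℝ, σ ≤ iteratedDeriv 2 f x) (hD0 : 0 < D)
    (hD : dataSize (u 0) = D) {t : ℝ} (ht : 0 ≤ t) (x : ℝ) : |u t x| ≤ D := by
  refine (hu.abs_le_decay hν hf hσ hconv hD0 hD ht x).trans (div_le_self hD0.le ?_)
  have : 0 ≤ σ * D * t := by positivity
  linarith

theorem deriv_le_dataSize (hu : IsBurgersSolution f ν u) (hν : 0 < ν) (hf : ContDiff ℝ ∞ f)
    (hσ : 0 < σ) (hconv : ∀ x : ℝ, σ ≤ iteratedDeriv 2 f x) (hD0 : 0 < D)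
    (hD : dataSize (u 0) = D) {t : ℝ} (ht : 0 < t) (x : ℝ) : deriv (u t) x ≤ D := by
  refine (le_of_hasDerivAt_of_one_sided zero_lt_one (hu.smoothForPos.hasDerivAt_space ht x)
    fun h hh => hu.sub_le_decay_mul hν hf hσ hconv hD0 hD ht.le x hh).trans
    (div_le_self hD0.le ?_)
  have : 0 ≤ σ * D * t := by positivity
  linarith

/-- A steep barrier `a h - b h²` on the short range `0 ≤ h ≤ δ`: its concavity makes viscosity
contribute `8 ν b`, which dominates the nonlinear term, at most `2 D M a`. -/
theorem neg_le_deriv (hu : IsBurgersSolution f ν u) (hν : 0 < ν) (hf : ContDiff ℝ ∞ f)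
    (hσ : 0 < σ) (hconv : ∀ x : ℝ, σ ≤ iteratedDeriv 2 f x) (hD0 : 0 < D)
    (hD : dataSize (u 0) = D) (hν1 : ν ≤ 1) {M : ℝ} (hM0 : 0 < M)
    (hM : ∀ x ∈ Icc (-D) D, iteratedDeriv 2 f x ≤ M) {t : ℝ} (ht : 0 < t) (x : ℝ) :
    -((4 * D ^ 2 * M + 2 * D) / ν) ≤ deriv (u t) x := by
  obtain ⟨L, hL⟩ := hu.lipschitz_initial
  set a := (4 * D ^ 2 * M + 2 * D) / ν with ha
  have hapos : 0 < a := by positivity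
  have haν : a * ν = 4 * D ^ 2 * M + 2 * D := by rw [ha]; field_simp
  have haD : 2 * D ≤ a := by
    rw [ha, le_div_iff₀ hν]
    -- The summand `2 * D` in `a` serves `2 D ≤ a`, needed for the initial increments; this is where
    -- `ν ≤ 1` enters.
    nlinarith [mul_pos (pow_pos hD0 2) hM0]
  set b := D * M * a / (2 * ν) with hb
  have hbpos : 0 < b := by positivity
  have hbν : 8 * ν * b = 4 * D * M * a := by rw [hb]; field_simp; norm_num
  -- Chosen so that `b δ = a / 2`: on `[0, δ]` the barrier is increasing and at least `a h / 2`. At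
  -- `h = δ` it is at least `2 D`, hence above any increment of `u`.
  set δ := ν / (D * M) with hδ
  have hδpos : 0 < δ := by positivity
  have hbδ : b * δ = a / 2 := by rw [hb, hδ]; field_simp
  have haδ : 4 * D ≤ a * δ := by
    rw [hδ, ← mul_div_assoc, haν, le_div_iff₀ (by positivity)]
    nlinarith
  have hbd := fun τ (hτ : 0 ≤ τ) x => abs_le.1 (hu.abs_le_dataSize hν hf hσ hconv hD0 hD hτ x)
  have key := hu.two_point_comparison hν (-1) (a := fun _ => a) (a' := fun _ => 0) (b := b)
    (c := 0) (H := δ) (T := t) le_rfl (fun τ _ => hasDerivAt_const τ a) ?_ ?_ ?_ t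
    ⟨ht.le, le_rfl⟩
  · have h1 : -deriv (u t) x ≤ a := by
      refine le_of_hasDerivAt_of_one_sided hδpos (hu.smoothForPos.hasDerivAt_space ht x).neg
        fun h hh => ?_
      have := key h hh x
      simp only [Pi.neg_apply]
      nlinarith [mul_nonneg hbpos.le (sq_nonneg h)]
    linarith
  · intro y h hh
    have h1 := abs_sub_le_of_dataSize hL (hu.periodic 0 le_rfl) hD y (y + h)
    rw [add_sub_cancel_left, abs_of_nonneg hh.1] at h1
    have h2 := (abs_le.1 h1).1
    have h3 : b * h ≤ a / 2 := hbδ ▸ mul_le_mul_of_nonneg_left hh.2 hbpos.le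
    nlinarith [mul_le_mul_of_nonneg_right h3 hh.1, mul_le_mul_of_nonneg_right haD hh.1]
  · intro τ hτ y
    have h1 := (hbd τ hτ.1 (y + δ)).1
    have h2 := (hbd τ hτ.1 y).2
    have h3 : b * δ ^ 2 = a * δ / 2 := by rw [pow_two, ← mul_assoc, hbδ]; ring
    linarith
  · intro τ hτ h hh y hlt
    have h3 : b * h ≤ a / 2 := hbδ ▸ mul_le_mul_of_nonneg_left hh.2.le hbpos.le
    have h4 : 0 ≤ a - 2 * b * h := by linarith
    have h5 : 0 ≤ a * h - b * h ^ 2 := by nlinarith [mul_le_mul_of_nonneg_right h3 hh.1.le, hh.1]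
    have h6 : u τ (y + h) ≤ u τ y := by linarith
    have h7 := deriv_sub_le_mul_sub hf hM
      (hu.abs_le_dataSize hν hf hσ hconv hD0 hD hτ.1.le (y + h))
      (hu.abs_le_dataSize hν hf hσ hconv hD0 hD hτ.1.le y) h6
    have h8 : deriv f (u τ y) - deriv f (u τ (y + h)) ≤ M * (2 * D) :=
      h7.trans (mul_le_mul_of_nonneg_left
        (by linarith [(hbd τ hτ.1.le y).2, (hbd τ hτ.1.le (y + h)).1]) hM0.le)
    have h9 := mul_le_mul_of_nonneg_right h8 h4
    have h10 : M * (2 * D) * (a - 2 * b * h) ≤ M * (2 * D) * a :=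
      mul_le_mul_of_nonneg_left (by nlinarith [mul_pos hbpos hh.1]) (by positivity)
    have h11 : 0 < D * M * a := by positivity
    rw [hbν]
    linarith
end IsBurgersSolution

/-! ### Energy estimates -/

theorem sobolevNorm_one_two_sq {v : ℝ → ℝ} (hv : Continuous (deriv v)) :
    sobolevNorm 1 2 v ^ 2 = ∫ x in (0 : ℝ)..1, deriv v x ^ 2 := by
  have hmem : MemLp (deriv v) 2 (volume.restrict (Ioc (0 : ℝ) 1)) := by
    obtain ⟨C, hC⟩ := isCompact_Icc.exists_bound_of_continuousOn (s := Icc (0 : ℝ) 1) hv.continuousOn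
    refine MemLp.of_bound hv.aestronglyMeasurable C ?_
    filter_upwards [ae_restrict_mem measurableSet_Ioc] with x hx
      using hC x (Ioc_subset_Icc_self hx)
  have h0 : 0 ≤ ∫ x in Ioc (0 : ℝ) 1, deriv v x ^ 2 := integral_nonneg fun x => sq_nonneg _
  rw [sobolevNorm, iteratedDeriv_one,
    hmem.eLpNorm_eq_integral_rpow_norm (by simp) (by simp),
    intervalIntegral.integral_of_le zero_le_one]
  have h1 : ∀ x, ‖deriv v x‖ ^ (2 : ENNReal).toReal = deriv v x ^ 2 := fun x => by
    rw [ENNReal.toReal_ofNat, Real.rpow_two, Real.norm_eq_abs, sq_abs]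
  simp_rw [h1]
  rw [ENNReal.toReal_ofReal (Real.rpow_nonneg h0 _), ENNReal.toReal_ofNat, ← Real.rpow_natCast,
    ← Real.rpow_mul h0]
  norm_num

theorem sobolevNorm_one_two_le {v : ℝ → ℝ} {D : ℝ} (hD : 0 ≤ D) (hv : ∀ᵐ x, |deriv v x| ≤ D) :
    sobolevNorm 1 2 v ≤ D := by
  rw [sobolevNorm, iteratedDeriv_one]
  refine ENNReal.toReal_le_of_le_ofReal hD ?_
  have := eLpNorm_le_of_ae_bound (p := 2) (μ := volume.restrict (Ioc (0 : ℝ) 1))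
    (f := deriv v) (C := D) (ae_restrict_of_ae hv)
  simpa using this

namespace IsBurgersSolution

variable {f : ℝ → ℝ} {ν σ D B : ℝ} {u : ℝ → ℝ → ℝ}

theorem integral_deriv_eq_zero (hu : IsBurgersSolution f ν u) {t : ℝ} (ht : 0 < t) :
    ∫ x in (0 : ℝ)..1, deriv (u t) x = 0 :=
  (hu.periodic t ht.le).integral_deriv_eq_zero (hu.smoothForPos.hasDerivAt_space ht)
    (hu.smoothForPos.deriv_space.continuous ht)

/-- One factor of `u_x²` is estimated by its supremum, the other in `L₁`, where zero mean and the
upper bound `D` give `2 D`. -/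
theorem integral_deriv_sq_le (hu : IsBurgersSolution f ν u) (hD0 : 0 ≤ D) (hB : 0 ≤ B) {t : ℝ}
    (ht : 0 < t) (hle : ∀ x, deriv (u t) x ≤ D) (habs : ∀ x, |deriv (u t) x| ≤ B) :
    ∫ x in (0 : ℝ)..1, deriv (u t) x ^ 2 ≤ 2 * D * B := by
  have hc := hu.smoothForPos.deriv_space.continuous ht
  have h1 := integral_abs_le_of_integral_eq_zero hc (hu.integral_deriv_eq_zero ht) hD0 hle
  have h2 : ∫ x in (0 : ℝ)..1, deriv (u t) x ^ 2
      ≤ ∫ x in (0 : ℝ)..1, B * |deriv (u t) x| := by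
    refine intervalIntegral.integral_mono_on zero_le_one ((hc.pow 2).intervalIntegrable _ _)
      ((hc.abs.const_mul B).intervalIntegrable _ _) fun x _ => ?_
    rw [← sq_abs, pow_two]
    exact mul_le_mul_of_nonneg_right (habs x) (abs_nonneg _)
  rw [intervalIntegral.integral_const_mul] at h2
  nlinarith [mul_le_mul_of_nonneg_left h1 hB]

theorem integral_sq_sub (hu : IsBurgersSolution f ν u) (hf : ContDiff ℝ ∞ f) {a b : ℝ}
    (ha : 0 < a) (hab : a ≤ b) :
    (∫ x in (0 : ℝ)..1, u b x ^ 2) - ∫ x in (0 : ℝ)..1, u a x ^ 2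
      = -(2 * ν) * ∫ t in a..b, ∫ x in (0 : ℝ)..1, deriv (u t) x ^ 2 := by
  have hsm := hu.smoothForPos
  have hf' : Continuous (deriv f) := hf.continuous_deriv (by simp)
  rw [integral_sub_integral_eq (g := fun t x => u t x ^ 2)
    (g' := fun t x => 2 * u t x * deriv (fun s => u s x) t) hab
    ((hsm.continuousOn_Icc ha).pow 2)
    (((hsm.continuousOn_Icc ha).const_mul 2).mul (hsm.deriv_time.continuousOn_Icc ha))
    (fun t ht x =>
      ((hsm.hasDerivAt_time (ha.trans_le ht.1) x).fun_pow 2).congr_deriv (by simp)),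
    ← intervalIntegral.integral_const_mul]
  refine intervalIntegral.integral_congr fun t ht => ?_
  rw [uIcc_of_le hab] at ht
  have ht0 : 0 < t := ha.trans_le ht.1
  have hp := hu.periodic t ht0.le
  have hp' := hp.deriv_periodic
  have hc := hsm.continuous ht0
  have hcx := hsm.deriv_space.continuous ht0
  have hct := hsm.deriv_time.continuous ht0
  have hsf : Continuous fun s => s * deriv f s := by fun_prop
  -- A primitive of `s f'(s)`: it makes the nonlinear contribution to the energy balance an exact
  -- `x`-derivative.
  have hG : ∀ y, HasDerivAt (fun y => ∫ s in (0 : ℝ)..y, s * deriv f s) (y * deriv f y) y :=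
    fun y => intervalIntegral.integral_hasDerivAt_right (hsf.intervalIntegrable _ _)
      (hsf.stronglyMeasurableAtFilter _ _) hsf.continuousAt
  have hi1 : IntervalIntegrable (fun x => 2 * u t x * deriv (fun s => u s x) t) volume 0 1 :=
    ((hc.const_mul 2).mul hct).intervalIntegrable _ _
  have hi2 : IntervalIntegrable (fun x => 2 * ν * deriv (u t) x ^ 2) volume 0 1 :=
    ((hcx.pow 2).const_mul _).intervalIntegrable _ _
  have hz : ∫ x in (0 : ℝ)..1, (2 * u t x * deriv (fun s => u s x) t
      + 2 * ν * deriv (u t) x ^ 2) = 0 := by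
    refine Function.Periodic.integral_deriv_eq_zero
      (v := fun x => -2 * (∫ s in (0 : ℝ)..u t x, s * deriv f s)
        + 2 * ν * (u t x * deriv (u t) x))
      (fun x => by simp only [hp x, hp' x]) (fun x => ?_)
      (((hc.const_mul 2).mul hct).add ((hcx.pow 2).const_mul _))
    have hx := hsm.hasDerivAt_space ht0 x
    refine ((((hG (u t x)).comp x hx).const_mul (-2)).add
      ((hx.mul (hsm.deriv_space.hasDerivAt_space ht0 x)).const_mul (2 * ν))).congr_deriv ?_
    rw [hu.deriv_time_eq ht0]
    ring
  rw [intervalIntegral.integral_add hi1 hi2, intervalIntegral.integral_const_mul] at hz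
  linarith

/-- Integration by parts gives `d/dt ∫ u_x² = -2 ∫ u_xx u_t`. After inserting the equation, Young's
inequality absorbs half of the viscous term. -/
theorem integral_deriv_sq_sub_le (hu : IsBurgersSolution f ν u) (hν : 0 < ν)
    {M₁ : ℝ} (hM₁ : ∀ x ∈ Icc (-D) D, |deriv f x| ≤ M₁) {a b : ℝ}
    (ha : 0 < a) (hab : a ≤ b) (hbd : ∀ t ∈ Icc a b, ∀ x, |u t x| ≤ D) :
    (∫ x in (0 : ℝ)..1, deriv (u b) x ^ 2) - ∫ x in (0 : ℝ)..1, deriv (u a) x ^ 2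
      ≤ M₁ ^ 2 / ν * (∫ t in a..b, ∫ x in (0 : ℝ)..1, deriv (u t) x ^ 2)
        - ν * ∫ t in a..b, ∫ x in (0 : ℝ)..1, deriv (deriv (u t)) x ^ 2 := by
  have hsm := hu.smoothForPos
  have hx2 := (hsm.deriv_space.continuousOn_Icc (b := b) ha).pow 2
  have hxx2 := (hsm.deriv_space.deriv_space.continuousOn_Icc (b := b) ha).pow 2
  have hg' := ((hsm.deriv_space.continuousOn_Icc (b := b) ha).const_mul 2).mul
    (hsm.deriv_space.deriv_time.continuousOn_Icc (b := b) ha)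
  have hI : ∀ {g : ℝ → ℝ → ℝ}, ContinuousOn (fun z : ℝ × ℝ => g z.1 z.2) (Icc a b ×ˢ univ) →
      IntervalIntegrable (fun t => ∫ x in (0 : ℝ)..1, g t x) volume a b := fun hg => by
    refine ContinuousOn.intervalIntegrable ?_
    rw [uIcc_of_le hab]
    exact continuousOn_intervalIntegral 0 1 hg
  rw [integral_sub_integral_eq (g := fun t x => deriv (u t) x ^ 2)
    (g' := fun t x => 2 * deriv (u t) x * deriv (fun s => deriv (u s) x) t) hab hx2 hg'
    (fun t ht x =>
      ((hsm.deriv_space.hasDerivAt_time (ha.trans_le ht.1) x).fun_pow 2).congr_deriv (by simp)),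
    ← intervalIntegral.integral_const_mul, ← intervalIntegral.integral_const_mul,
    ← intervalIntegral.integral_sub ((hI hx2).const_mul _) ((hI hxx2).const_mul _)]
  refine intervalIntegral.integral_mono_on hab (hI hg')
    (((hI hx2).const_mul _).sub ((hI hxx2).const_mul _)) fun t ht => ?_
  have ht0 : 0 < t := ha.trans_le ht.1
  have hp := hu.periodic t ht0.le
  have hp' := hp.deriv_periodic
  have hcx := hsm.deriv_space.continuous ht0
  have hcxx := hsm.deriv_space.deriv_space.continuous ht0
  have hct := hsm.deriv_time.continuous ht0
  have hcxt := hsm.deriv_space.deriv_time.continuous ht0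
  have hpt : Function.Periodic (fun x => deriv (fun s => u s x) t) 1 := fun x => by
    simp only
    refine Filter.EventuallyEq.deriv_eq ?_
    filter_upwards [Ioi_mem_nhds ht0] with s hs using hu.periodic s (le_of_lt hs) x
  have hi1 : IntervalIntegrable
      (fun x => 2 * deriv (u t) x * deriv (fun s => deriv (u s) x) t) volume 0 1 :=
    ((hcx.const_mul 2).mul hcxt).intervalIntegrable _ _
  have hi2 : IntervalIntegrable
      (fun x => 2 * deriv (deriv (u t)) x * deriv (fun s => u s x) t) volume 0 1 :=
    ((hcxx.const_mul 2).mul hct).intervalIntegrable _ _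
  have hi3 : IntervalIntegrable (fun x => M₁ ^ 2 / ν * deriv (u t) x ^ 2) volume 0 1 :=
    ((hcx.pow 2).const_mul _).intervalIntegrable _ _
  have hi4 : IntervalIntegrable (fun x => ν * deriv (deriv (u t)) x ^ 2) volume 0 1 :=
    ((hcxx.pow 2).const_mul _).intervalIntegrable _ _
  have hz : ∫ x in (0 : ℝ)..1, (2 * deriv (u t) x * deriv (fun s => deriv (u s) x) t
      + 2 * deriv (deriv (u t)) x * deriv (fun s => u s x) t) = 0 := by
    refine Function.Periodic.integral_deriv_eq_zero
      (v := fun x => 2 * (deriv (u t) x * deriv (fun s => u s x) t))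
      (fun x => by
        have := hpt x
        simp only at this
        simp only [hp' x, this]) (fun x => ?_)
      (((hcx.const_mul 2).mul hcxt).add ((hcxx.const_mul 2).mul hct))
    refine (((hsm.deriv_space.hasDerivAt_space ht0 x).mul
      (hsm.deriv_time.hasDerivAt_space ht0 x)).const_mul 2).congr_deriv ?_
    rw [hsm.deriv_comm ht0]
    ring
  rw [intervalIntegral.integral_add hi1 hi2] at hz
  have hz' : ∫ x in (0 : ℝ)..1, 2 * deriv (u t) x * deriv (fun s => deriv (u s) x) t
      = ∫ x in (0 : ℝ)..1, -(2 * deriv (deriv (u t)) x * deriv (fun s => u s x) t) := by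
    rw [intervalIntegral.integral_neg]
    linarith
  rw [hz', ← intervalIntegral.integral_const_mul, ← intervalIntegral.integral_const_mul,
    ← intervalIntegral.integral_sub hi3 hi4]
  refine intervalIntegral.integral_mono_on zero_le_one hi2.neg (hi3.sub hi4)
    fun x _ => ?_
  rw [hu.deriv_time_eq ht0]
  have hfu := hM₁ (u t x) (_root_.abs_le.1 (hbd t ht x))
  set p := deriv (u t) x
  set q := deriv (deriv (u t)) x
  set w := deriv f (u t x)
  have h1 : w ^ 2 ≤ M₁ ^ 2 := by
    rw [← sq_abs w]
    exact pow_le_pow_left₀ (abs_nonneg _) hfu 2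
  -- Young's inequality `2 w p q ≤ w² p² / ν + ν q²`.
  have h2 : 0 ≤ (w * p - ν * q) ^ 2 / ν := by positivity
  have h3 : (w * p - ν * q) ^ 2 / ν = w ^ 2 / ν * p ^ 2 - 2 * w * p * q + ν * q ^ 2 := by
    field_simp
    ring
  have h4 : w ^ 2 / ν * p ^ 2 ≤ M₁ ^ 2 / ν * p ^ 2 := by gcongr
  linarith

/-- The initial energy is at least `|u₀|_1² ≥ D⁻²`, and the rate of loss `2 ν ∫ u_x²` is at most `2
A`. The identity holds on `[s, T]` with `s > 0`, and `s` tends to zero. -/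
theorem inv_sq_sub_le_integral_sq (hu : IsBurgersSolution f ν u) (hν : 0 < ν)
    (hf : ContDiff ℝ ∞ f) (hD0 : 0 < D) (hD : dataSize (u 0) = D) {A : ℝ} (hA0 : 0 ≤ A)
    (hA : ∀ t, 0 < t → ∫ x in (0 : ℝ)..1, deriv (u t) x ^ 2 ≤ A * ν⁻¹) {T : ℝ} (hT : 0 < T) :
    (D⁻¹) ^ 2 - 2 * A * T ≤ ∫ x in (0 : ℝ)..1, u T x ^ 2 := by
  have hsm := hu.smoothForPos
  have h0 : (D⁻¹) ^ 2 ≤ ∫ x in (0 : ℝ)..1, u 0 x ^ 2 := by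
    have hc := hu.continuous le_rfl
    have h1 := inv_le_integral_abs_of_dataSize hc (hu.periodic 0 le_rfl) hD0 hD
    have h2 := sq_integral_le zero_le_one hc.abs.continuousOn
    simp only [sq_abs, sub_zero, one_mul] at h2
    exact (pow_le_pow_left₀ (inv_nonneg.2 hD0.le) h1 2).trans h2
  refine le_trans (sub_le_sub_right h0 _) ?_
  have hcont := continuousOn_intervalIntegral (g := fun t x => u t x ^ 2) 0 1
    (hu.continuousOn.pow 2) 0 self_mem_Ici
  have hlim := ((hcont.mono_left (nhdsWithin_mono 0 Ioi_subset_Ici_self)).sub_const (2 * A * T))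
  refine le_of_tendsto hlim ?_
  filter_upwards [Ioc_mem_nhdsGT hT] with s hs
  have h1 := hu.integral_sq_sub hf hs.1 hs.2
  have h2 : ∫ t in s..T, ∫ x in (0 : ℝ)..1, deriv (u t) x ^ 2 ≤ ∫ _ in s..T, A * ν⁻¹ := by
    refine intervalIntegral.integral_mono_on hs.2 ?_ (by simp) fun t ht => hA t (hs.1.trans_le ht.1)
    refine ContinuousOn.intervalIntegrable ?_
    rw [uIcc_of_le hs.2]
    exact continuousOn_intervalIntegral (g := fun t x => deriv (u t) x ^ 2) 0 1
      ((hsm.deriv_space.continuousOn_Icc hs.1).pow 2)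
  rw [intervalIntegral.integral_const, smul_eq_mul] at h2
  have h3 := mul_le_mul_of_nonneg_left h2 (show 0 ≤ 2 * ν by positivity)
  have h4 : 2 * ν * ((T - s) * (A * ν⁻¹)) = 2 * A * (T - s) := by field_simp
  have h5 : 0 ≤ A * s := mul_nonneg hA0 hs.1.le
  linarith

/-- The dissipation between two suitable times is bounded below uniformly in the viscosity. -/
theorem inv_le_dissipation (hu : IsBurgersSolution f ν u) (hν : 0 < ν)
    (hf : ContDiff ℝ ∞ f) (hσ : 0 < σ) (hconv : ∀ x : ℝ, σ ≤ iteratedDeriv 2 f x)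
    (hD0 : 0 < D) (hD : dataSize (u 0) = D) {A : ℝ} (hA0 : 0 < A)
    (hA : ∀ t, 0 < t → ∫ x in (0 : ℝ)..1, deriv (u t) x ^ 2 ≤ A * ν⁻¹) :
    1 / (4 * D ^ 2) ≤ 2 * ν * ∫ t in timeOne D A..timeTwo σ D A,
      ∫ x in (0 : ℝ)..1, deriv (u t) x ^ 2 := by
  have hT1 : 0 < timeOne D A := by unfold timeOne; positivity
  have hT12 : timeOne D A ≤ timeTwo σ D A :=
    le_trans (by linarith) (le_max_left _ _)
  have h1 := hu.integral_sq_sub hf hT1 hT12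
  have h2 := hu.inv_sq_sub_le_integral_sq hν hf hD0 hD hA0.le hA hT1
  have h3 : 2 * A * timeOne D A = 1 / (2 * D ^ 2) := by
    unfold timeOne
    field_simp
    norm_num
  have hT2 : 2 * D / σ ≤ timeTwo σ D A := le_max_right _ _
  have hT20 : 0 < timeTwo σ D A := hT1.trans_le hT12
  have h4 : ∫ x in (0 : ℝ)..1, u (timeTwo σ D A) x ^ 2 ≤ ∫ _ in (0 : ℝ)..1, 1 / (4 * D ^ 2) := by
    refine intervalIntegral.integral_mono_on zero_le_one
      (((hu.continuous hT20.le).pow 2).intervalIntegrable _ _) (by simp) fun x _ => ?_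
    have h5 := hu.abs_le_decay hν hf hσ hconv hD0 hD hT20.le x
    -- Since `σ T₂ ≥ 2 D`, the denominator exceeds `2 D²`.
    have h6 : D / (1 + σ * D * timeTwo σ D A) ≤ 1 / (2 * D) := by
      rw [div_le_div_iff₀ (by positivity) (by positivity)]
      rw [div_le_iff₀ hσ] at hT2
      nlinarith
    have h7 : |u (timeTwo σ D A) x| ≤ 1 / (2 * D) := h5.trans h6
    rw [← sq_abs]
    refine (pow_le_pow_left₀ (abs_nonneg _) h7 2).trans (le_of_eq ?_)
    field_simp
    norm_num
  simp only [intervalIntegral.integral_const, sub_zero, one_smul] at h4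
  have h8 : (D⁻¹) ^ 2 - 1 / (2 * D ^ 2) - 1 / (4 * D ^ 2) = 1 / (4 * D ^ 2) := by
    field_simp
    norm_num
  linarith

end IsBurgersSolution

/-! ### Increments of a function of one variable -/

/-- The moment of order `p` of the increments of `v` at scale `ℓ`. -/
noncomputable def incrementMoment (v : ℝ → ℝ) (p ℓ : ℝ) : ℝ :=
  ∫ x in (0 : ℝ)..1, |v (x + ℓ) - v x| ^ p

section Increments

variable {v : ℝ → ℝ} {D ℓ Λ p : ℝ}

theorem continuous_increment (hv : Continuous v) : Continuous fun x => v (x + ℓ) - v x := by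
  fun_prop

theorem intervalIntegrable_increment_rpow (hv : Continuous v) (hp : 0 ≤ p) (a b : ℝ) :
    IntervalIntegrable (fun x => |v (x + ℓ) - v x| ^ p) volume a b :=
  ((continuous_increment hv).abs.rpow_const fun _ => Or.inr hp).intervalIntegrable _ _

theorem integral_increment_eq_zero (hv : Continuous v) (hper : Function.Periodic v 1) :
    ∫ x in (0 : ℝ)..1, (v (x + ℓ) - v x) = 0 := by
  have hv' : Continuous fun x => v (x + ℓ) := by fun_prop
  rw [intervalIntegral.integral_sub (hv'.intervalIntegrable _ _)
    (hv.intervalIntegrable _ _), hper.integral_shift, sub_self]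

theorem incrementMoment_one : incrementMoment v 1 ℓ = ∫ x in (0 : ℝ)..1, |v (x + ℓ) - v x| := by
  simp [incrementMoment]

theorem incrementMoment_two : incrementMoment v 2 ℓ = ∫ x in (0 : ℝ)..1, (v (x + ℓ) - v x) ^ 2 := by
  simp [incrementMoment]

theorem incrementMoment_nonneg : 0 ≤ incrementMoment v p ℓ :=
  intervalIntegral.integral_nonneg zero_le_one fun _ _ => Real.rpow_nonneg (abs_nonneg _) _

theorem incrementMoment_one_le (hv : Continuous v) (hper : Function.Periodic v 1)
    (hD : 0 ≤ D * ℓ) (hle : ∀ x, v (x + ℓ) - v x ≤ D * ℓ) :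
    incrementMoment v 1 ℓ ≤ 2 * (D * ℓ) := by
  rw [incrementMoment_one]
  exact integral_abs_le_of_integral_eq_zero (continuous_increment hv)
    (integral_increment_eq_zero hv hper) hD hle

theorem incrementMoment_le_of_one_le (hv : Continuous v) (hp : 1 ≤ p)
    (habs : ∀ x, |v (x + ℓ) - v x| ≤ Λ) :
    incrementMoment v p ℓ ≤ Λ ^ (p - 1) * incrementMoment v 1 ℓ := by
  rw [incrementMoment, incrementMoment, ← intervalIntegral.integral_const_mul]
  refine intervalIntegral.integral_mono_on zero_le_one
    (intervalIntegrable_increment_rpow hv (by linarith) _ _)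
    ((intervalIntegrable_increment_rpow hv zero_le_one _ _).const_mul _) fun x _ => ?_
  have h0 := abs_nonneg (v (x + ℓ) - v x)
  calc |v (x + ℓ) - v x| ^ p = |v (x + ℓ) - v x| ^ (p - 1) * |v (x + ℓ) - v x| ^ (1 : ℝ) := by
        rw [← Real.rpow_add_of_nonneg h0 (by linarith) zero_le_one, sub_add_cancel]
    _ ≤ _ := mul_le_mul_of_nonneg_right
        (Real.rpow_le_rpow h0 (habs x) (by linarith)) (Real.rpow_nonneg h0 _)

/-- Pointwise in `a = |v (x + ℓ) - v x|`: the quantity `a² - ε Λ a` is nonpositive for `a ≤ ε Λ`;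
otherwise it is at most `Λ²` while `a ^ p ≥ (ε Λ) ^ p`. -/
theorem le_incrementMoment_of_one_le (hv : Continuous v) (hp : 1 ≤ p) (hΛ : 0 < Λ) {ε : ℝ}
    (hε : 0 < ε) (habs : ∀ x, |v (x + ℓ) - v x| ≤ Λ) :
    ε ^ p * Λ ^ (p - 2) * (incrementMoment v 2 ℓ - ε * Λ * incrementMoment v 1 ℓ)
      ≤ incrementMoment v p ℓ := by
  have h1 := (intervalIntegrable_increment_rpow (ℓ := ℓ) hv zero_le_one 0 1).const_mul (ε * Λ)
  have h2 := intervalIntegrable_increment_rpow (ℓ := ℓ) hv zero_le_two 0 1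
  rw [incrementMoment, incrementMoment, incrementMoment, ← intervalIntegral.integral_const_mul,
    ← intervalIntegral.integral_sub h2 h1, ← intervalIntegral.integral_const_mul]
  refine intervalIntegral.integral_mono_on zero_le_one ((h2.sub h1).const_mul _)
    (intervalIntegrable_increment_rpow hv (by linarith) _ _) fun x _ => ?_
  have h0 := abs_nonneg (v (x + ℓ) - v x)
  have hx := habs x
  set a := |v (x + ℓ) - v x|
  rw [Real.rpow_one, Real.rpow_two]
  have hc : 0 < ε ^ p * Λ ^ (p - 2) := by positivity
  rcases le_total a (ε * Λ) with h | h
  · refine le_trans ?_ (Real.rpow_nonneg h0 p)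
    exact mul_nonpos_of_nonneg_of_nonpos hc.le (by nlinarith)
  · have h3 : a ^ 2 - ε * Λ * a ≤ Λ ^ 2 := by
      have : 0 ≤ ε * Λ * a := by positivity
      nlinarith
    calc ε ^ p * Λ ^ (p - 2) * (a ^ 2 - ε * Λ * a) ≤ ε ^ p * Λ ^ (p - 2) * Λ ^ 2 :=
          mul_le_mul_of_nonneg_left h3 hc.le
      _ = (ε * Λ) ^ p := by
          rw [Real.mul_rpow hε.le hΛ.le, mul_assoc, ← Real.rpow_two, ← Real.rpow_add hΛ,
            sub_add_cancel]
      _ ≤ a ^ p := Real.rpow_le_rpow (by positivity) h (by linarith)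

theorem incrementMoment_le_of_le_one (hv : Continuous v) (hp0 : 0 ≤ p) (hp : p ≤ 1) (hℓ : 0 < ℓ) :
    incrementMoment v p ℓ ≤ ℓ ^ p + ℓ ^ (p - 1) * incrementMoment v 1 ℓ := by
  have h1 := (intervalIntegrable_increment_rpow (ℓ := ℓ) hv zero_le_one 0 1).const_mul (ℓ ^ (p - 1))
  have h2 : ℓ ^ p = ∫ _ in (0 : ℝ)..1, ℓ ^ p := by simp
  rw [incrementMoment, incrementMoment, ← intervalIntegral.integral_const_mul, h2,
    ← intervalIntegral.integral_add (by simp) h1]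
  refine intervalIntegral.integral_mono_on zero_le_one
    (intervalIntegrable_increment_rpow hv hp0 _ _) (IntervalIntegrable.add (by simp) h1)
    fun x _ => ?_
  have h0 := abs_nonneg (v (x + ℓ) - v x)
  set a := |v (x + ℓ) - v x|
  rw [Real.rpow_one]
  rcases le_total a ℓ with h | h
  · have := Real.rpow_le_rpow h0 h hp0
    have : 0 ≤ ℓ ^ (p - 1) * a := by positivity
    linarith
  · have ha : 0 < a := hℓ.trans_le h
    have h3 : a ^ p = a ^ (p - 1) * a := by
      rw [← Real.rpow_add_one ha.ne', sub_add_cancel]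
    have h4 : a ^ (p - 1) * a ≤ ℓ ^ (p - 1) * a :=
      mul_le_mul_of_nonneg_right (Real.rpow_le_rpow_of_nonpos hℓ h (by linarith)) h0
    have : 0 ≤ ℓ ^ p := by positivity
    linarith

/-- Increments have zero mean, so their positive part carries half of the first moment. It takes
values in `[0, D ℓ]`, where `w ^ p ≥ (D ℓ) ^ (p - 1) * w` for `p ≤ 1`. -/
theorem le_incrementMoment_of_le_one (hv : Continuous v) (hper : Function.Periodic v 1)
    (hp0 : 0 ≤ p) (hp : p ≤ 1) (hle : ∀ x, v (x + ℓ) - v x ≤ D * ℓ) :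
    (D * ℓ) ^ (p - 1) / 2 * incrementMoment v 1 ℓ ≤ incrementMoment v p ℓ := by
  have hc := continuous_increment (ℓ := ℓ) hv
  have h1 : incrementMoment v 1 ℓ
      = ∫ x in (0 : ℝ)..1, (|v (x + ℓ) - v x| + (v (x + ℓ) - v x)) := by
    rw [incrementMoment_one, intervalIntegral.integral_add (hc.abs.intervalIntegrable _ _)
      (hc.intervalIntegrable _ _), integral_increment_eq_zero hv hper, add_zero]
  rw [h1, incrementMoment, ← intervalIntegral.integral_const_mul]
  refine intervalIntegral.integral_mono_on zero_le_one
    (((hc.abs.add hc).const_mul _).intervalIntegrable _ _)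
    (intervalIntegrable_increment_rpow hv hp0 _ _) fun x _ => ?_
  have hx := hle x
  set w := v (x + ℓ) - v x
  rcases le_or_gt w 0 with h | h
  · rw [abs_of_nonpos h, neg_add_cancel, mul_zero]
    exact Real.rpow_nonneg (by linarith) _
  · rw [abs_of_pos h]
    have h3 : w ^ p = w ^ (p - 1) * w := by
      rw [← Real.rpow_add_one h.ne', sub_add_cancel]
    have h4 : (D * ℓ) ^ (p - 1) * w ≤ w ^ (p - 1) * w :=
      mul_le_mul_of_nonneg_right (Real.rpow_le_rpow_of_nonpos h hx (by linarith)) h.le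
    linarith

/-- Second-order Taylor estimate in the mean square. -/
theorem le_incrementMoment_two {v' v'' : ℝ → ℝ} (hper : Function.Periodic v'' 1)
    (hv' : ∀ x, HasDerivAt v (v' x) x) (hv'' : ∀ x, HasDerivAt v' (v'' x) x)
    (hc : Continuous v'') (hℓ : 0 ≤ ℓ) :
    ℓ ^ 2 / 2 * (∫ x in (0 : ℝ)..1, v' x ^ 2) - ℓ ^ 4 * (∫ x in (0 : ℝ)..1, v'' x ^ 2)
      ≤ incrementMoment v 2 ℓ := by
  have hcv : Continuous v := continuous_iff_continuousAt.2 fun x => (hv' x).continuousAt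
  have hcv' : Continuous v' := continuous_iff_continuousAt.2 fun x => (hv'' x).continuousAt
  have htaylor : ∀ x, (v (x + ℓ) - v x - ℓ * v' x) ^ 2
      ≤ ℓ ^ 3 * ∫ s in (0 : ℝ)..ℓ, v'' (x + s) ^ 2 := by
    intro x
    have hw : Continuous fun s => (ℓ - s) * v'' (x + s) := by fun_prop
    have hF : ∀ s, HasDerivAt (fun s => (ℓ - s) * v' (x + s) + v (x + s))
        ((ℓ - s) * v'' (x + s)) s := by
      intro s
      have hs : HasDerivAt (fun s : ℝ => x + s) 1 s := (hasDerivAt_id s).const_add x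
      have hs' : HasDerivAt (fun s : ℝ => ℓ - s) (-1) s := (hasDerivAt_id s).const_sub ℓ
      refine ((hs'.mul ((hv'' _).comp s hs)).add ((hv' _).comp s hs)).congr_deriv ?_
      simp
    have h1 : ∫ s in (0 : ℝ)..ℓ, (ℓ - s) * v'' (x + s) = v (x + ℓ) - v x - ℓ * v' x := by
      rw [intervalIntegral.integral_eq_sub_of_hasDerivAt (fun s _ => hF s)
        (hw.intervalIntegrable _ _)]
      simp
      ring
    rw [← h1]
    refine (sq_integral_le hℓ hw.continuousOn).trans ?_
    have h2 : ∫ s in (0 : ℝ)..ℓ, ((ℓ - s) * v'' (x + s)) ^ 2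
        ≤ ∫ s in (0 : ℝ)..ℓ, ℓ ^ 2 * v'' (x + s) ^ 2 := by
      refine intervalIntegral.integral_mono_on hℓ ((hw.pow 2).intervalIntegrable _ _)
        (Continuous.intervalIntegrable (by fun_prop) _ _) fun s hs => ?_
      rw [mul_pow]
      exact mul_le_mul_of_nonneg_right
        (pow_le_pow_left₀ (by linarith [hs.2]) (by linarith [hs.1]) 2) (sq_nonneg _)
    rw [intervalIntegral.integral_const_mul] at h2
    have h3 := mul_le_mul_of_nonneg_left h2 hℓ
    rw [sub_zero]
    linarith
  have hfub : ∫ x in (0 : ℝ)..1, ∫ s in (0 : ℝ)..ℓ, v'' (x + s) ^ 2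
      = ℓ * ∫ x in (0 : ℝ)..1, v'' x ^ 2 := by
    rw [intervalIntegral_swap_of_continuousOn (g := fun x s => v'' (x + s) ^ 2) zero_le_one hℓ
      (Continuous.continuousOn (by fun_prop))]
    have hp2 : Function.Periodic (fun x => v'' x ^ 2) 1 := fun x => by simp only [hper x]
    simp_rw [fun s => hp2.integral_shift s]
    simp
  have hcs : Continuous fun x => ∫ s in (0 : ℝ)..ℓ, v'' (x + s) ^ 2 :=
    intervalIntegral.continuous_parametric_intervalIntegral_of_continuous'
      (f := fun x s => v'' (x + s) ^ 2) (by fun_prop) 0 ℓ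
  have hi1 : IntervalIntegrable (fun x => ℓ ^ 2 / 2 * v' x ^ 2) volume 0 1 :=
    Continuous.intervalIntegrable (by fun_prop) _ _
  have hi2 : IntervalIntegrable (fun x => ℓ ^ 3 * ∫ s in (0 : ℝ)..ℓ, v'' (x + s) ^ 2) volume 0 1 :=
    (hcs.const_mul _).intervalIntegrable _ _
  have hfin : ∫ x in (0 : ℝ)..1, (ℓ ^ 2 / 2 * v' x ^ 2 - ℓ ^ 3 * ∫ s in (0 : ℝ)..ℓ, v'' (x + s) ^ 2)
      ≤ incrementMoment v 2 ℓ := by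
    rw [incrementMoment_two]
    refine intervalIntegral.integral_mono_on zero_le_one (hi1.sub hi2)
      (((continuous_increment hcv).pow 2).intervalIntegrable _ _) fun x _ => ?_
    -- With `δ` the increment and `r = δ - ℓ v'`, one has `δ² + r² - ℓ² v'² / 2 = (2 δ - ℓ v')² /
    -- 2`.
    nlinarith [htaylor x, sq_nonneg (2 * (v (x + ℓ) - v x) - ℓ * v' x)]
  rw [intervalIntegral.integral_sub hi1 hi2, intervalIntegral.integral_const_mul,
    intervalIntegral.integral_const_mul, hfub] at hfin
  linarith

/-- A drop at a small scale persists at larger scales, because increments are bounded above. -/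
theorem cliff_le_incrementMoment_two (hv : Continuous v) (hper : Function.Periodic v 1)
    (hD : 0 < D) (hle : ∀ x, ∀ h, 0 ≤ h → v (x + h) - v x ≤ D * h) (habs : ∀ x, |v x| ≤ D)
    {ℓ₀ ε : ℝ} (hℓ₀ : 0 < ℓ₀) (hℓ : 2 * ℓ₀ ≤ ℓ) (hℓ1 : ℓ ≤ 1) (hε : 2 * (D * ℓ) ≤ ε) :
    ε ^ 2 / (32 * D ^ 2) * (ℓ / ℓ₀) * (incrementMoment v 2 ℓ₀ - ε * incrementMoment v 1 ℓ₀)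
      ≤ incrementMoment v 2 ℓ := by
  have hℓpos : 0 < ℓ := by linarith
  have hεpos : 0 < ε := lt_of_lt_of_le (by positivity) hε
  have hDℓ : D * ℓ₀ ≤ ε := by nlinarith
  have hconst : 0 < ε ^ 2 / (32 * D ^ 2) * (ℓ / ℓ₀) := by positivity
  -- Either a drop exceeding `ε` exists at scale `ℓ₀`, or all increments there are at most `ε` in
  -- size and the left side is nonpositive. Being linear in the moments, the inequality can then be
  -- averaged in time without singling out good times.
  by_cases hex : ∃ x, v (x + ℓ₀) - v x < -ε
  · obtain ⟨x, hx⟩ := hex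
    -- For these `y` the interval `[y, y + ℓ]` contains `[x, x + ℓ₀]`; outside the drop `v` regains
    -- at most `D (ℓ - ℓ₀) ≤ ε / 2`.
    have hdrop : ∀ y ∈ Icc (x + ℓ₀ - ℓ) x, (ε / 2) ^ 2 ≤ (v (y + ℓ) - v y) ^ 2 := by
      intro y hy
      have h1 := hle (x + ℓ₀) (y + ℓ - (x + ℓ₀)) (by linarith [hy.1])
      have h2 := hle y (x - y) (by linarith [hy.2])
      rw [add_sub_cancel] at h1 h2
      have h3 : 0 < D * ℓ₀ := by positivity
      have h4 : v (y + ℓ) - v y ≤ -(ε / 2) := by nlinarith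
      nlinarith
    have hcont : Continuous fun y => (v (y + ℓ) - v y) ^ 2 := by fun_prop
    have hp2 : Function.Periodic (fun y => (v (y + ℓ) - v y) ^ 2) 1 := fun y => by
      have : y + 1 + ℓ = y + ℓ + 1 := by ring
      simp only [this, hper _]
    have hlow : (ℓ - ℓ₀) * (ε / 2) ^ 2 ≤ incrementMoment v 2 ℓ := by
      have h5 := hp2.intervalIntegral_add_eq (x + ℓ₀ - ℓ) 0
      rw [zero_add] at h5
      rw [incrementMoment_two, ← h5]
      rw [← intervalIntegral.integral_add_adjacent_intervals (b := x)
        (hcont.intervalIntegrable _ _) (hcont.intervalIntegrable _ _)]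
      have h6 : ∫ _ in (x + ℓ₀ - ℓ)..x, (ε / 2) ^ 2
          ≤ ∫ y in (x + ℓ₀ - ℓ)..x, (v (y + ℓ) - v y) ^ 2 :=
        intervalIntegral.integral_mono_on (by linarith) (by simp)
          (hcont.intervalIntegrable _ _) hdrop
      have h7 : 0 ≤ ∫ y in x..(x + ℓ₀ - ℓ + 1), (v (y + ℓ) - v y) ^ 2 :=
        intervalIntegral.integral_nonneg (by linarith) fun _ _ => sq_nonneg _
      rw [intervalIntegral.integral_const, smul_eq_mul] at h6
      have : x - (x + ℓ₀ - ℓ) = ℓ - ℓ₀ := by ring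
      rw [this] at h6
      linarith
    have hup : incrementMoment v 2 ℓ₀ ≤ 2 * D * (2 * (D * ℓ₀)) := by
      have h8 := incrementMoment_le_of_one_le (ℓ := ℓ₀) (Λ := 2 * D) hv one_le_two fun x => by
        have := abs_sub (v (x + ℓ₀)) (v x)
        linarith [habs x, habs (x + ℓ₀)]
      have h9 := incrementMoment_one_le hv hper (by positivity) fun x => hle x ℓ₀ hℓ₀.le
      norm_num at h8
      nlinarith
    have h10 : 0 ≤ ε * incrementMoment v 1 ℓ₀ := mul_nonneg hεpos.le incrementMoment_nonneg
    calc ε ^ 2 / (32 * D ^ 2) * (ℓ / ℓ₀) * (incrementMoment v 2 ℓ₀ - ε * incrementMoment v 1 ℓ₀)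
        ≤ ε ^ 2 / (32 * D ^ 2) * (ℓ / ℓ₀) * (2 * D * (2 * (D * ℓ₀))) :=
          mul_le_mul_of_nonneg_left (by linarith) hconst.le
      _ = ℓ / 2 * (ε / 2) ^ 2 := by
          field_simp
          norm_num
      _ ≤ (ℓ - ℓ₀) * (ε / 2) ^ 2 := mul_le_mul_of_nonneg_right (by linarith) (sq_nonneg _)
      _ ≤ _ := hlow
  · push Not at hex
    refine le_trans ?_ incrementMoment_nonneg
    refine mul_nonpos_of_nonneg_of_nonpos hconst.le (sub_nonpos.2 ?_)
    have h8 := incrementMoment_le_of_one_le (ℓ := ℓ₀) (Λ := ε) hv one_le_two fun x =>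
      abs_le.2 ⟨hex x, (hle x ℓ₀ hℓ₀.le).trans hDℓ⟩
    norm_num at h8
    exact h8

end Increments

/-! ### Time averages -/

section TimeAverage

variable {T₁ T₂ : ℝ} {A B : ℝ → ℝ}

theorem timeAverage_mono (hT : T₁ < T₂) (hA : ContinuousOn A (Icc T₁ T₂))
    (hB : ContinuousOn B (Icc T₁ T₂)) (hle : ∀ t ∈ Icc T₁ T₂, A t ≤ B t) :
    timeAverage T₁ T₂ A ≤ timeAverage T₁ T₂ B := by
  rw [← uIcc_of_le hT.le] at hA hB
  exact mul_le_mul_of_nonneg_left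
    (intervalIntegral.integral_mono_on hT.le hA.intervalIntegrable hB.intervalIntegrable hle)
    (by have := sub_pos.2 hT; positivity)

theorem timeAverage_const (hT : T₁ < T₂) (c : ℝ) : timeAverage T₁ T₂ (fun _ => c) = c := by
  have := (sub_pos.2 hT).ne'
  rw [timeAverage, intervalIntegral.integral_const, smul_eq_mul]
  field_simp

theorem timeAverage_const_mul (c : ℝ) :
    timeAverage T₁ T₂ (fun t => c * A t) = c * timeAverage T₁ T₂ A := by
  rw [timeAverage, timeAverage, intervalIntegral.integral_const_mul]
  ring

theorem timeAverage_sub (hT : T₁ < T₂) (hA : ContinuousOn A (Icc T₁ T₂))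
    (hB : ContinuousOn B (Icc T₁ T₂)) :
    timeAverage T₁ T₂ (fun t => A t - B t) = timeAverage T₁ T₂ A - timeAverage T₁ T₂ B := by
  rw [← uIcc_of_le hT.le] at hA hB
  rw [timeAverage, timeAverage, timeAverage,
    intervalIntegral.integral_sub hA.intervalIntegrable hB.intervalIntegrable]
  ring

theorem timeAverage_add (hT : T₁ < T₂) (hA : ContinuousOn A (Icc T₁ T₂))
    (hB : ContinuousOn B (Icc T₁ T₂)) :
    timeAverage T₁ T₂ (fun t => A t + B t) = timeAverage T₁ T₂ A + timeAverage T₁ T₂ B := by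
  rw [← uIcc_of_le hT.le] at hA hB
  rw [timeAverage, timeAverage, timeAverage,
    intervalIntegral.integral_add hA.intervalIntegrable hB.intervalIntegrable]
  ring

end TimeAverage

/-! ### Structure functions -/

theorem structureFunction_eq (T₁ T₂ : ℝ) (u : ℝ → ℝ → ℝ) (p ℓ : ℝ) :
    structureFunction T₁ T₂ u p ℓ = timeAverage T₁ T₂ fun t => incrementMoment (u t) p ℓ := rfl

theorem SmoothForPos.continuousOn_incrementMoment {u : ℝ → ℝ → ℝ} (hu : SmoothForPos u)
    {T₁ T₂ : ℝ} (hT : 0 < T₁) {p : ℝ} (hp : 0 ≤ p) (ℓ : ℝ) :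
    ContinuousOn (fun t => incrementMoment (u t) p ℓ) (Icc T₁ T₂) := by
  refine continuousOn_intervalIntegral (g := fun t x => |u t (x + ℓ) - u t x| ^ p) 0 1 ?_
  have h := hu.continuousOn_Icc (b := T₂) hT
  have h' : ContinuousOn (fun z : ℝ × ℝ => u z.1 (z.2 + ℓ)) (Icc T₁ T₂ ×ˢ univ) :=
    h.comp (f := fun z : ℝ × ℝ => (z.1, z.2 + ℓ)) (by fun_prop) fun z hz => ⟨hz.1, mem_univ _⟩
  exact (h'.sub h).abs.rpow_const fun _ _ => Or.inr hp

theorem SmoothForPos.continuousOn_integral_sq {u : ℝ → ℝ → ℝ} (hu : SmoothForPos u)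
    {T₁ T₂ : ℝ} (hT : 0 < T₁) :
    ContinuousOn (fun t => ∫ x in (0 : ℝ)..1, u t x ^ 2) (Icc T₁ T₂) :=
  continuousOn_intervalIntegral (g := fun t x => u t x ^ 2) 0 1 ((hu.continuousOn_Icc hT).pow 2)

/-- Bounds on the increments of `u` at scale `ℓ` which determine all structure functions at that
scale: a one-sided Lipschitz bound, a bound `Λ` on the size, and a matching lower bound on the
second moment. -/
structure IncrementControl (T₁ T₂ D c : ℝ) (u : ℝ → ℝ → ℝ) (ℓ Λ : ℝ) : Prop where
  time_pos : 0 < T₁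
  time_lt : T₁ < T₂
  smooth : SmoothForPos u
  periodic : ∀ t ∈ Icc T₁ T₂, Function.Periodic (u t) 1
  scale_pos : 0 < ℓ
  size_pos : 0 < Λ
  increment_le : ∀ t ∈ Icc T₁ T₂, ∀ x, u t (x + ℓ) - u t x ≤ D * ℓ
  abs_increment_le : ∀ t ∈ Icc T₁ T₂, ∀ x, |u t (x + ℓ) - u t x| ≤ Λ
  le_second : c * (ℓ * Λ) ≤ structureFunction T₁ T₂ u 2 ℓ

namespace IncrementControl

variable {T₁ T₂ D c ℓ Λ p : ℝ} {u : ℝ → ℝ → ℝ}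

theorem continuous (h : IncrementControl T₁ T₂ D c u ℓ Λ) {t : ℝ} (ht : t ∈ Icc T₁ T₂) :
    Continuous (u t) := h.smooth.continuous (h.time_pos.trans_le ht.1)

theorem first_le (h : IncrementControl T₁ T₂ D c u ℓ Λ) (hD : 0 < D) :
    structureFunction T₁ T₂ u 1 ℓ ≤ 2 * (D * ℓ) := by
  rw [structureFunction_eq, ← timeAverage_const h.time_lt (2 * (D * ℓ))]
  exact timeAverage_mono h.time_lt (h.smooth.continuousOn_incrementMoment h.time_pos zero_le_one ℓ)
    continuousOn_const fun t ht => incrementMoment_one_le (h.continuous ht) (h.periodic t ht)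
      (mul_pos hD h.scale_pos).le (h.increment_le t ht)

theorem structureFunction_le_of_one_le (h : IncrementControl T₁ T₂ D c u ℓ Λ) (hD : 0 < D)
    (hp : 1 ≤ p) : structureFunction T₁ T₂ u p ℓ ≤ 2 * D * (ℓ * Λ ^ (p - 1)) := by
  have hΛ := h.size_pos
  have h1 : structureFunction T₁ T₂ u p ℓ ≤ Λ ^ (p - 1) * structureFunction T₁ T₂ u 1 ℓ := by
    rw [structureFunction_eq, structureFunction_eq, ← timeAverage_const_mul]
    exact timeAverage_mono h.time_lt
      (h.smooth.continuousOn_incrementMoment h.time_pos (by linarith) ℓ)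
      ((h.smooth.continuousOn_incrementMoment h.time_pos zero_le_one ℓ).const_mul _)
      fun t ht => incrementMoment_le_of_one_le (h.continuous ht) hp (h.abs_increment_le t ht)
  have h2 := mul_le_mul_of_nonneg_left (h.first_le hD) (show 0 ≤ Λ ^ (p - 1) by positivity)
  linarith

theorem le_structureFunction_of_one_le (h : IncrementControl T₁ T₂ D c u ℓ Λ) (hD : 0 < D)
    (hc : 0 < c) (hp : 1 ≤ p) :
    (c / (4 * D)) ^ p * (c / 2) * (ℓ * Λ ^ (p - 1)) ≤ structureFunction T₁ T₂ u p ℓ := by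
  have hΛ := h.size_pos
  have hℓ := h.scale_pos
  -- With this `ε` and `S₁ ≤ 2 D ℓ`, the subtracted term is at most half of the lower bound for
  -- `S₂`.
  set ε := c / (4 * D) with hε
  have hεpos : 0 < ε := by positivity
  have hc1 := h.smooth.continuousOn_incrementMoment (T₂ := T₂) h.time_pos zero_le_one ℓ
  have hc2 := h.smooth.continuousOn_incrementMoment (T₂ := T₂) h.time_pos zero_le_two ℓ
  have h1 : ε ^ p * Λ ^ (p - 2) * (structureFunction T₁ T₂ u 2 ℓ
      - ε * Λ * structureFunction T₁ T₂ u 1 ℓ) ≤ structureFunction T₁ T₂ u p ℓ := by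
    rw [structureFunction_eq, structureFunction_eq, structureFunction_eq,
      ← timeAverage_const_mul (ε * Λ), ← timeAverage_sub h.time_lt hc2 (hc1.const_mul _),
      ← timeAverage_const_mul]
    exact timeAverage_mono h.time_lt ((hc2.sub (hc1.const_mul _)).const_mul _)
      (h.smooth.continuousOn_incrementMoment h.time_pos (by linarith) ℓ)
      fun t ht => le_incrementMoment_of_one_le (h.continuous ht) hp hΛ hεpos
        (h.abs_increment_le t ht)
  refine le_trans ?_ h1
  have h2 := mul_le_mul_of_nonneg_left (h.first_le hD) (mul_pos hεpos hΛ).le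
  have h3 : ε * Λ * (2 * (D * ℓ)) = c / 2 * (ℓ * Λ) := by
    rw [hε]
    field_simp
    norm_num
  have h4 : c / 2 * (ℓ * Λ) ≤ structureFunction T₁ T₂ u 2 ℓ
      - ε * Λ * structureFunction T₁ T₂ u 1 ℓ := by linarith [h.le_second]
  have h5 : Λ ^ (p - 1) = Λ ^ (p - 2) * Λ := by
    rw [← Real.rpow_add_one hΛ.ne']
    congr 1
    ring
  calc ε ^ p * (c / 2) * (ℓ * Λ ^ (p - 1)) = ε ^ p * Λ ^ (p - 2) * (c / 2 * (ℓ * Λ)) := by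
        rw [h5]; ring
    _ ≤ _ := mul_le_mul_of_nonneg_left h4 (by positivity)

theorem structureFunction_le_of_le_one (h : IncrementControl T₁ T₂ D c u ℓ Λ) (hD : 0 < D)
    (hp0 : 0 ≤ p) (hp : p ≤ 1) : structureFunction T₁ T₂ u p ℓ ≤ (1 + 2 * D) * ℓ ^ p := by
  have hℓ := h.scale_pos
  have hc1 := h.smooth.continuousOn_incrementMoment (T₂ := T₂) h.time_pos zero_le_one ℓ
  have h1 : structureFunction T₁ T₂ u p ℓ
      ≤ ℓ ^ p + ℓ ^ (p - 1) * structureFunction T₁ T₂ u 1 ℓ := by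
    rw [structureFunction_eq, structureFunction_eq, ← timeAverage_const_mul,
      ← timeAverage_const h.time_lt (ℓ ^ p),
      ← timeAverage_add h.time_lt continuousOn_const (hc1.const_mul _)]
    exact timeAverage_mono h.time_lt
      (h.smooth.continuousOn_incrementMoment h.time_pos hp0 ℓ)
      (continuousOn_const.add (hc1.const_mul _))
      fun t ht => incrementMoment_le_of_le_one (h.continuous ht) hp0 hp hℓ
  have h2 := mul_le_mul_of_nonneg_left (h.first_le hD) (show 0 ≤ ℓ ^ (p - 1) by positivity)
  have h3 : ℓ ^ p = ℓ ^ (p - 1) * ℓ := by rw [← Real.rpow_add_one hℓ.ne', sub_add_cancel]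
  have h4 : ℓ ^ (p - 1) * (2 * (D * ℓ)) = 2 * D * ℓ ^ p := by rw [h3]; ring
  linarith

theorem le_structureFunction_of_le_one (h : IncrementControl T₁ T₂ D c u ℓ Λ) (hD : 0 < D)
    (hc : 0 < c) (hp0 : 0 ≤ p) (hp : p ≤ 1) :
    D ^ (p - 1) / 2 * (c / (4 * D) * (c / 2)) * ℓ ^ p ≤ structureFunction T₁ T₂ u p ℓ := by
  have hℓ := h.scale_pos
  have hc1 := h.smooth.continuousOn_incrementMoment (T₂ := T₂) h.time_pos zero_le_one ℓ
  have h1 : (D * ℓ) ^ (p - 1) / 2 * structureFunction T₁ T₂ u 1 ℓ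
      ≤ structureFunction T₁ T₂ u p ℓ := by
    rw [structureFunction_eq, structureFunction_eq, ← timeAverage_const_mul]
    exact timeAverage_mono h.time_lt (hc1.const_mul _)
      (h.smooth.continuousOn_incrementMoment h.time_pos hp0 ℓ)
      fun t ht => le_incrementMoment_of_le_one (h.continuous ht) (h.periodic t ht) hp0 hp
        (h.increment_le t ht)
  refine le_trans ?_ h1
  have h2 := h.le_structureFunction_of_one_le hD hc le_rfl
  rw [sub_self, Real.rpow_zero, Real.rpow_one, mul_one] at h2
  have h3 : ℓ ^ p = ℓ ^ (p - 1) * ℓ := by rw [← Real.rpow_add_one hℓ.ne', sub_add_cancel]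
  calc D ^ (p - 1) / 2 * (c / (4 * D) * (c / 2)) * ℓ ^ p
      = (D * ℓ) ^ (p - 1) / 2 * (c / (4 * D) * (c / 2) * ℓ) := by
        rw [h3, Real.mul_rpow hD.le hℓ.le]; ring
    _ ≤ _ := mul_le_mul_of_nonneg_left h2 (by positivity)

end IncrementControl

/-! ### Comparability constants -/

theorem comparable_of_le {C m M X Y : ℝ} (hm : 0 < m) (hmC : m⁻¹ ≤ C) (hMC : M ≤ C) (hY : 0 ≤ Y)
    (hl : m * Y ≤ X) (hr : X ≤ M * Y) : Comparable C X Y :=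
  ⟨(mul_le_mul_of_nonneg_right (inv_le_of_inv_le₀ hm hmC) hY).trans hl,
    hr.trans (mul_le_mul_of_nonneg_right hMC hY)⟩

theorem Comparable.mono {C C' X Y : ℝ} (hC : 0 < C) (hCC' : C ≤ C') (hY : 0 ≤ Y)
    (h : Comparable C X Y) : Comparable C' X Y :=
  comparable_of_le (inv_pos.2 hC) (by rwa [inv_inv]) hCC' hY h.1 h.2

theorem Comparable.of_mul {C k X Y : ℝ} (hC : 0 < C) (hk : 0 < k) (hY : 0 ≤ Y)
    (h : Comparable C X (k * Y)) : Comparable (C * (k + k⁻¹)) X Y := by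
  have hk' := inv_pos.2 hk
  refine comparable_of_le (m := C⁻¹ * k) (M := C * k) (by positivity) ?_
    (mul_le_mul_of_nonneg_left (by linarith) hC.le) hY (by linarith [h.1]) (by linarith [h.2])
  rw [mul_inv, inv_inv]
  exact mul_le_mul_of_nonneg_left (by linarith) hC.le

theorem exists_comparable_structureFunction {D c p : ℝ} (hD : 0 < D) (hc : 0 < c) (hp0 : 0 ≤ p) :
    ∃ C, 0 < C ∧ ∀ {T₁ T₂ : ℝ} {u : ℝ → ℝ → ℝ} {ℓ Λ : ℝ}, IncrementControl T₁ T₂ D c u ℓ Λ →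
      (p ≤ 1 → Comparable C (structureFunction T₁ T₂ u p ℓ) (ℓ ^ p)) ∧
      (1 ≤ p → Comparable C (structureFunction T₁ T₂ u p ℓ) (ℓ * Λ ^ (p - 1))) := by
  set m₁ := D ^ (p - 1) / 2 * (c / (4 * D) * (c / 2)) with hm₁
  set m₂ := (c / (4 * D)) ^ p * (c / 2) with hm₂
  have hm₁pos : 0 < m₁ := by positivity
  have hm₂pos : 0 < m₂ := by positivity
  have h1 := inv_pos.2 hm₁pos
  have h2 := inv_pos.2 hm₂pos
  refine ⟨m₁⁻¹ + m₂⁻¹ + (1 + 2 * D), by positivity, fun h => ⟨fun hp => ?_, fun hp => ?_⟩⟩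
  · have := h.scale_pos
    exact comparable_of_le hm₁pos (by linarith) (M := 1 + 2 * D) (by linarith) (by positivity)
      (h.le_structureFunction_of_le_one hD hc hp0 hp) (h.structureFunction_le_of_le_one hD hp0 hp)
  · have := h.scale_pos
    have := h.size_pos
    exact comparable_of_le hm₂pos (by linarith) (M := 2 * D) (by linarith) (by positivity)
      (h.le_structureFunction_of_one_le hD hc hp) (h.structureFunction_le_of_one_le hD hp)

theorem comparable_flatness {T₁ T₂ ℓ C₂ C₄ : ℝ} {u : ℝ → ℝ → ℝ} (hℓ : 0 < ℓ) (hC₂ : 0 < C₂)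
    (hC₄ : 0 < C₄) (h₂ : Comparable C₂ (structureFunction T₁ T₂ u 2 ℓ) ℓ)
    (h₄ : Comparable C₄ (structureFunction T₁ T₂ u 4 ℓ) ℓ) :
    Comparable (C₄ * C₂ ^ 2) (flatness T₁ T₂ u ℓ) ℓ⁻¹ := by
  obtain ⟨h₂l, h₂r⟩ := h₂
  obtain ⟨h₄l, h₄r⟩ := h₄
  have hl2 : 0 < C₂⁻¹ * ℓ := by positivity
  have hl4 : 0 < C₄⁻¹ * ℓ := by positivity
  rw [flatness]
  set S₂ := structureFunction T₁ T₂ u 2 ℓ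
  set S₄ := structureFunction T₁ T₂ u 4 ℓ
  have hS₂ : 0 < S₂ := hl2.trans_le h₂l
  constructor
  · calc (C₄ * C₂ ^ 2)⁻¹ * ℓ⁻¹ = C₄⁻¹ * ℓ / (C₂ * ℓ) ^ 2 := by field_simp
      _ ≤ S₄ / S₂ ^ 2 := by gcongr; exact hl4.le.trans h₄l
  · calc S₄ / S₂ ^ 2 ≤ C₄ * ℓ / (C₂⁻¹ * ℓ) ^ 2 := by gcongr
      _ = C₄ * C₂ ^ 2 * ℓ⁻¹ := by field_simp

/-! ### Lower bounds on the second structure function -/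

/-- The smallness condition lets the Taylor remainder `ℓ⁴ A / ν³` consume at most half of the main
term `c ℓ² / (2 ν)`. -/
theorem SmoothForPos.le_structureFunction_two_of_small {u : ℝ → ℝ → ℝ} (hu : SmoothForPos u)
    {T₁ T₂ ν c A ℓ : ℝ} (hT : 0 < T₁) (hT' : T₁ < T₂) (hν : 0 < ν)
    (hper : ∀ t ∈ Icc T₁ T₂, Function.Periodic (u t) 1)
    (hc : c / ν ≤ timeAverage T₁ T₂ fun t => ∫ x in (0 : ℝ)..1, deriv (u t) x ^ 2)
    (hA : (timeAverage T₁ T₂ fun t => ∫ x in (0 : ℝ)..1, deriv (deriv (u t)) x ^ 2) ≤ A / ν ^ 3)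
    (hℓ : 0 ≤ ℓ) (hsmall : 4 * A * ℓ ^ 2 ≤ c * ν ^ 2) :
    c / 4 * (ℓ ^ 2 / ν) ≤ structureFunction T₁ T₂ u 2 ℓ := by
  have hx := hu.deriv_space.continuousOn_integral_sq (T₂ := T₂) hT
  have hxx := hu.deriv_space.deriv_space.continuousOn_integral_sq (T₂ := T₂) hT
  have h1 : ℓ ^ 2 / 2 * (timeAverage T₁ T₂ fun t => ∫ x in (0 : ℝ)..1, deriv (u t) x ^ 2)
      - ℓ ^ 4 * (timeAverage T₁ T₂ fun t => ∫ x in (0 : ℝ)..1, deriv (deriv (u t)) x ^ 2)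
      ≤ structureFunction T₁ T₂ u 2 ℓ := by
    rw [structureFunction_eq, ← timeAverage_const_mul, ← timeAverage_const_mul,
      ← timeAverage_sub hT' (hx.const_mul _) (hxx.const_mul _)]
    refine timeAverage_mono hT' ((hx.const_mul _).sub (hxx.const_mul _))
      (hu.continuousOn_incrementMoment hT zero_le_two ℓ) fun t ht => ?_
    have ht0 : 0 < t := hT.trans_le ht.1
    exact le_incrementMoment_two (hper t ht).deriv_periodic.deriv_periodic
      (hu.hasDerivAt_space ht0) (hu.deriv_space.hasDerivAt_space ht0)
      (hu.deriv_space.deriv_space.continuous ht0) hℓ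
  have h2 := mul_le_mul_of_nonneg_left hc (show 0 ≤ ℓ ^ 2 / 2 by positivity)
  have h3 := mul_le_mul_of_nonneg_left hA (show 0 ≤ ℓ ^ 4 by positivity)
  have h4 := mul_le_mul_of_nonneg_left hsmall (show 0 ≤ ℓ ^ 2 / (4 * ν ^ 3) by positivity)
  have h5 : ℓ ^ 2 / (4 * ν ^ 3) * (4 * A * ℓ ^ 2) = ℓ ^ 4 * (A / ν ^ 3) := by
    field_simp
  have h6 : ℓ ^ 2 / (4 * ν ^ 3) * (c * ν ^ 2) = c / 4 * (ℓ ^ 2 / ν) := by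
    field_simp
  have h7 : ℓ ^ 2 / 2 * (c / ν) = c / 2 * (ℓ ^ 2 / ν) := by ring
  linarith

theorem SmoothForPos.cliff_le_structureFunction_two {u : ℝ → ℝ → ℝ} (hu : SmoothForPos u)
    {T₁ T₂ D ℓ ℓ₀ ε : ℝ} (hT : 0 < T₁) (hT' : T₁ < T₂) (hD : 0 < D)
    (hper : ∀ t ∈ Icc T₁ T₂, Function.Periodic (u t) 1)
    (hle : ∀ t ∈ Icc T₁ T₂, ∀ x, ∀ h, 0 ≤ h → u t (x + h) - u t x ≤ D * h)
    (habs : ∀ t ∈ Icc T₁ T₂, ∀ x, |u t x| ≤ D)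
    (hℓ₀ : 0 < ℓ₀) (hℓ : 2 * ℓ₀ ≤ ℓ) (hℓ1 : ℓ ≤ 1) (hε : 2 * (D * ℓ) ≤ ε) :
    ε ^ 2 / (32 * D ^ 2) * (ℓ / ℓ₀)
        * (structureFunction T₁ T₂ u 2 ℓ₀ - ε * structureFunction T₁ T₂ u 1 ℓ₀)
      ≤ structureFunction T₁ T₂ u 2 ℓ := by
  have hc1 := hu.continuousOn_incrementMoment (T₂ := T₂) hT zero_le_one ℓ₀
  have hc2 := hu.continuousOn_incrementMoment (T₂ := T₂) hT zero_le_two ℓ₀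
  rw [structureFunction_eq, structureFunction_eq, structureFunction_eq,
    ← timeAverage_const_mul ε, ← timeAverage_sub hT' hc2 (hc1.const_mul _),
    ← timeAverage_const_mul]
  exact timeAverage_mono hT' ((hc2.sub (hc1.const_mul _)).const_mul _)
    (hu.continuousOn_incrementMoment hT zero_le_two ℓ) fun t ht =>
      cliff_le_incrementMoment_two (hu.continuous (hT.trans_le ht.1)) (hper t ht) hD (hle t ht)
        (habs t ht) hℓ₀ hℓ hℓ1 hε

/-! ### Uniform control of the increments of solutions -/

namespace IsBurgersSolution

variable {f : ℝ → ℝ} {ν σ D B M₁ : ℝ} {u : ℝ → ℝ → ℝ}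

theorem sub_le_mul (hu : IsBurgersSolution f ν u) {t : ℝ} (ht : 0 < t)
    (hle : ∀ x, deriv (u t) x ≤ D) (x : ℝ) {h : ℝ} (hh : 0 ≤ h) :
    u t (x + h) - u t x ≤ D * h := by
  have hd : Differentiable ℝ (u t) := fun x =>
    (hu.smoothForPos.hasDerivAt_space ht x).differentiableAt
  have := convex_univ.image_sub_le_mul_sub_of_deriv_le hd.continuous.continuousOn
    hd.differentiableOn (fun z _ => hle z) x (mem_univ _) (x + h) (mem_univ _) (by linarith)
  rwa [add_sub_cancel_left] at this

theorem abs_sub_le_mul (hu : IsBurgersSolution f ν u) {t : ℝ} (ht : 0 < t)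
    (habs : ∀ x, |deriv (u t) x| ≤ B) (x : ℝ) {h : ℝ} (hh : 0 ≤ h) :
    |u t (x + h) - u t x| ≤ B * h := by
  have := convex_univ.norm_image_sub_le_of_norm_deriv_le (f := u t) (C := B)
    (fun z _ => (hu.smoothForPos.hasDerivAt_space ht z).differentiableAt) (fun z _ => habs z)
    (mem_univ x) (mem_univ (x + h))
  rwa [add_sub_cancel_left, Real.norm_eq_abs, Real.norm_eq_abs, abs_of_nonneg hh] at this

/-- The integrated `H¹` inequality with the final-time term dropped. The term at `T₁` only costs
`ν⁻²`, which `ν ≤ 1` absorbs into `ν⁻³`. -/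
theorem timeAverage_deriv_deriv_sq_le (hu : IsBurgersSolution f ν u) (hν : 0 < ν) (hν1 : ν ≤ 1)
    (hM₁ : ∀ x ∈ Icc (-D) D, |deriv f x| ≤ M₁) {A T₁ T₂ : ℝ} (hA0 : 0 ≤ A)
    (hA : ∀ t, 0 < t → ∫ x in (0 : ℝ)..1, deriv (u t) x ^ 2 ≤ A * ν⁻¹)
    (hbd : ∀ t, 0 < t → ∀ x, |u t x| ≤ D) (hT : 0 < T₁) (hT' : T₁ < T₂) :
    (timeAverage T₁ T₂ fun t => ∫ x in (0 : ℝ)..1, deriv (deriv (u t)) x ^ 2)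
      ≤ A * (1 / (T₂ - T₁) + M₁ ^ 2) / ν ^ 3 := by
  have hτ : 0 < T₂ - T₁ := sub_pos.2 hT'
  have h1 := hu.integral_deriv_sq_sub_le hν hM₁ hT hT'.le fun t ht => hbd t (hT.trans_le ht.1)
  have h2 := hA T₁ hT
  have h3 : 0 ≤ ∫ x in (0 : ℝ)..1, deriv (u T₂) x ^ 2 :=
    intervalIntegral.integral_nonneg zero_le_one fun _ _ => sq_nonneg _
  have h4 : (timeAverage T₁ T₂ fun t => ∫ x in (0 : ℝ)..1, deriv (u t) x ^ 2) ≤ A * ν⁻¹ := by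
    rw [← timeAverage_const hT' (A * ν⁻¹)]
    exact timeAverage_mono hT' (hu.smoothForPos.deriv_space.continuousOn_integral_sq hT)
      continuousOn_const fun t ht => hA t (hT.trans_le ht.1)
  rw [timeAverage] at h4 ⊢
  set I₁ := ∫ t in T₁..T₂, ∫ x in (0 : ℝ)..1, deriv (u t) x ^ 2
  set I₂ := ∫ t in T₁..T₂, ∫ x in (0 : ℝ)..1, deriv (deriv (u t)) x ^ 2
  have h5 : ν * I₂ ≤ A * ν⁻¹ + M₁ ^ 2 / ν * I₁ := by linarith
  have h6 : 1 / (T₂ - T₁) * (ν * I₂)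
      ≤ 1 / (T₂ - T₁) * (A * ν⁻¹) + M₁ ^ 2 / ν * (1 / (T₂ - T₁) * I₁) := by
    have := mul_le_mul_of_nonneg_left h5 (one_div_pos.2 hτ).le
    linarith
  have h7 : M₁ ^ 2 / ν * (1 / (T₂ - T₁) * I₁) ≤ M₁ ^ 2 / ν * (A * ν⁻¹) :=
    mul_le_mul_of_nonneg_left h4 (by positivity)
  have h8 : 1 / (T₂ - T₁) * (A * ν⁻¹) ≤ 1 / (T₂ - T₁) * (A * (ν⁻¹ * ν⁻¹)) := by
    have : ν⁻¹ ≤ ν⁻¹ * ν⁻¹ := le_mul_of_one_le_left (by positivity) ((one_le_inv₀ hν).2 hν1)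
    gcongr
  rw [le_div_iff₀ (by positivity)]
  calc 1 / (T₂ - T₁) * I₂ * ν ^ 3 = ν ^ 2 * (1 / (T₂ - T₁) * (ν * I₂)) := by ring
    _ ≤ ν ^ 2 * (1 / (T₂ - T₁) * (A * (ν⁻¹ * ν⁻¹)) + M₁ ^ 2 / ν * (A * ν⁻¹)) :=
        mul_le_mul_of_nonneg_left (by linarith) (by positivity)
    _ = A * (1 / (T₂ - T₁) + M₁ ^ 2) := by field_simp

end IsBurgersSolution

theorem timeOne_pos {D C : ℝ} (hD : 0 < D) (hC : 0 < C) : 0 < timeOne D C := by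
  unfold timeOne
  positivity

theorem timeOne_lt_timeTwo {D C : ℝ} (σ : ℝ) (hD : 0 < D) (hC : 0 < C) :
    timeOne D C < timeTwo σ D C :=
  lt_of_lt_of_le (by linarith [timeOne_pos hD hC]) (le_max_left _ _)

/-- Bounds on solutions with data of size `D` that are uniform in the viscosity. -/
theorem exists_uniform_bounds {f : ℝ → ℝ} (hf : ContDiff ℝ ∞ f) {σ : ℝ} (hσ : 0 < σ)
    (hconv : ∀ x : ℝ, σ ≤ iteratedDeriv 2 f x) {D : ℝ} (hD : 0 < D) :
    ∃ B M₁ Ct : ℝ, 0 < B ∧ 0 < Ct ∧ (∀ x ∈ Icc (-D) D, |deriv f x| ≤ M₁) ∧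
      ∀ ν ∈ Ioc (0 : ℝ) 1, ∀ u : ℝ → ℝ → ℝ, IsBurgersSolution f ν u → dataSize (u 0) = D →
        (∀ t, 0 ≤ t → sobolevNorm 1 2 (u t) ^ 2 ≤ Ct * ν⁻¹) ∧
        ∀ t, 0 < t → (∀ x, |deriv (u t) x| ≤ B / ν) ∧
          ∫ x in (0 : ℝ)..1, deriv (u t) x ^ 2 ≤ Ct * ν⁻¹ := by
  have hf' : Continuous (deriv f) := hf.continuous_deriv (by simp)
  have hf'' : Continuous (iteratedDeriv 2 f) := hf.continuous_iteratedDeriv 2 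
    (by simpa using WithTop.coe_le_coe.2 (le_top : (2 : ℕ∞) ≤ ⊤))
  obtain ⟨M₁, hM₁⟩ := isCompact_Icc.exists_bound_of_continuousOn (s := Icc (-D) D) hf'.continuousOn
  obtain ⟨M, hM⟩ := isCompact_Icc.exists_bound_of_continuousOn (s := Icc (-D) D) hf''.continuousOn
  have hM' : ∀ x ∈ Icc (-D) D, iteratedDeriv 2 f x ≤ M := fun x hx =>
    (le_abs_self _).trans (hM x hx)
  have hM0 : 0 < M := hσ.trans_le ((hconv 0).trans (hM' 0 ⟨by linarith, hD.le⟩))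
  set B := 4 * D ^ 2 * M + 2 * D with hB
  have hBpos : 0 < B := by positivity
  have hDB : D ≤ B := by
    have : 0 < 4 * D ^ 2 * M := by positivity
    linarith
  -- The summand `D ^ 2` covers `t = 0`, where `u 0` is merely Lipschitz; `2 * D * B` covers
  -- positive times.
  refine ⟨B, M₁, D ^ 2 + 2 * D * B, hBpos, by positivity, hM₁, fun ν hν u hu hDu => ?_⟩
  have hpos : ∀ t, 0 < t → (∀ x, |deriv (u t) x| ≤ B / ν) ∧
      ∫ x in (0 : ℝ)..1, deriv (u t) x ^ 2 ≤ (D ^ 2 + 2 * D * B) * ν⁻¹ := by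
    intro t ht
    have hle := hu.deriv_le_dataSize hν.1 hf hσ hconv hD hDu ht
    have habs : ∀ x, |deriv (u t) x| ≤ B / ν := fun x => by
      refine abs_le.2 ⟨hu.neg_le_deriv hν.1 hf hσ hconv hD hDu hν.2 hM0 hM' ht x,
        (hle x).trans (hDB.trans ?_)⟩
      rw [le_div_iff₀ hν.1]
      exact mul_le_of_le_one_right hBpos.le hν.2
    refine ⟨habs, ?_⟩
    have h1 := hu.integral_deriv_sq_le hD.le (div_pos hBpos hν.1).le ht hle habs
    have h2 : 0 ≤ D ^ 2 * ν⁻¹ := mul_nonneg (sq_nonneg D) (inv_pos.2 hν.1).le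
    calc _ ≤ 2 * D * (B / ν) := h1
      _ ≤ D ^ 2 * ν⁻¹ + 2 * D * (B / ν) := by linarith
      _ = _ := by ring
  refine ⟨fun t ht => ?_, hpos⟩
  rcases ht.eq_or_lt with rfl | ht0
  · obtain ⟨L, hL⟩ := hu.lipschitz_initial
    have h1 := sobolevNorm_one_two_le hD.le
      (ae_abs_deriv_le_of_dataSize hL (hu.periodic 0 le_rfl) hDu)
    have h2 : sobolevNorm 1 2 (u 0) ^ 2 ≤ D ^ 2 :=
      pow_le_pow_left₀ ENNReal.toReal_nonneg h1 2
    have h3 : 0 ≤ 2 * D * B := by positivity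
    have h4 : 1 ≤ ν⁻¹ := (one_le_inv₀ hν.1).2 hν.2
    calc _ ≤ D ^ 2 := h2
      _ ≤ D ^ 2 + 2 * D * B := by linarith
      _ ≤ _ := le_mul_of_one_le_right (by positivity) h4
  · rw [sobolevNorm_one_two_sq (hu.smoothForPos.deriv_space.continuous ht0)]
    exact (hpos t ht0).2

theorem exists_incrementControl {f : ℝ → ℝ} (hf : ContDiff ℝ ∞ f) {σ : ℝ} (hσ : 0 < σ)
    (hconv : ∀ x : ℝ, σ ≤ iteratedDeriv 2 f x) {D : ℝ} (hD : 0 < D) :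
    ∃ Ct : ℝ, 0 < Ct ∧
      (∀ ν ∈ Ioc (0 : ℝ) 1, ∀ u : ℝ → ℝ → ℝ, IsBurgersSolution f ν u → dataSize (u 0) = D →
        ∀ t, 0 ≤ t → sobolevNorm 1 2 (u t) ^ 2 ≤ Ct * ν⁻¹) ∧
      ∃ K B c : ℝ, 1 < K ∧ 0 < B ∧ 0 < c ∧ ∀ ν ∈ Ioc (0 : ℝ) (viscosityBound K),
        ∀ u : ℝ → ℝ → ℝ, IsBurgersSolution f ν u → dataSize (u 0) = D →
          (∀ ℓ ∈ dissipationRange K ν,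
            IncrementControl (timeOne D Ct) (timeTwo σ D Ct) D c u ℓ (B / ν * ℓ)) ∧
          ∀ ℓ ∈ inertialRange K ν,
            IncrementControl (timeOne D Ct) (timeTwo σ D Ct) D c u ℓ (2 * D) := by
  obtain ⟨B, M₁, Ct, hB, hCt, hM₁, hbounds⟩ := exists_uniform_bounds hf hσ hconv hD
  refine ⟨Ct, hCt, fun ν hν u hu hDu => (hbounds ν hν u hu hDu).1, ?_⟩
  set T₁ := timeOne D Ct with hT₁
  set T₂ := timeTwo σ D Ct with hT₂
  have hT : 0 < T₁ := timeOne_pos hD hCt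
  have hT' : T₁ < T₂ := timeOne_lt_timeTwo σ hD hCt
  have hτ : 0 < T₂ - T₁ := sub_pos.2 hT'
  -- The dissipation bound `1 / (4 D²)` divided by `2 (T₂ - T₁)`: the time average of `∫ u_x²` is at
  -- least `c₁ / ν`.
  set c₁ := 1 / (8 * D ^ 2 * (T₂ - T₁)) with hc₁
  have hc₁pos : 0 < c₁ := by positivity
  set A := Ct * (1 / (T₂ - T₁) + M₁ ^ 2) with hA
  have hApos : 0 < A := by positivity
  -- The term in `A` makes scales up to `C₁ ν` small enough for the Taylor estimate. The term in `D`
  -- gives `2 D C₂ ≤ ε`, which amounts to `12.8 D² ≤ c₁ K²`. The `2` ensures `K > 1`.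
  set K := 2 + 13 * D ^ 2 / c₁ + A / c₁ with hK
  have hq₁ : 0 < 13 * D ^ 2 / c₁ := by positivity
  have hq₂ : 0 < A / c₁ := by positivity
  have hK1 : 1 < K := by linarith
  have hK0 : 0 < K := by linarith
  have hKK : K ≤ K ^ 2 := le_self_pow₀ hK1.le two_ne_zero
  have hKK' : K ≤ K ^ 4 := le_self_pow₀ hK1.le four_ne_zero
  have hKD : 13 * D ^ 2 ≤ c₁ * K ^ 2 := by
    have : 13 * D ^ 2 / c₁ ≤ K ^ 2 := by linarith
    rw [div_le_iff₀ hc₁pos] at this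
    linarith
  have hKA : A ≤ c₁ * K ^ 4 := by
    have : A / c₁ ≤ K ^ 4 := by linarith
    rw [div_le_iff₀ hc₁pos] at this
    linarith
  -- Chosen so that `ε · 2 D ℓ₀` is half of the lower bound `c₁ ℓ₀ / (32 K²)` for `S₂(ℓ₀)`.
  set ε := c₁ / (128 * D * K ^ 2) with hε
  have hεpos : 0 < ε := by positivity
  set c₃ := ε ^ 2 / (32 * D ^ 2) * (c₁ / (64 * K ^ 2)) with hc₃
  have hc₃pos : 0 < c₃ := by positivity
  refine ⟨K, B, min (c₁ / (4 * B)) (c₃ / (2 * D)), hK1, hB, by positivity,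
    fun ν hν u hu hDu => ?_⟩
  have hν0 := hν.1
  have hν1 : ν ≤ 1 := by
    refine hν.2.trans ?_
    rw [viscosityBound, div_le_one (by positivity)]
    linarith
  have hsol := (hbounds ν ⟨hν0, hν1⟩ u hu hDu).2
  have hsm := hu.smoothForPos
  have hper : ∀ t ∈ Icc T₁ T₂, Function.Periodic (u t) 1 := fun t ht =>
    hu.periodic t (hT.le.trans ht.1)
  have hone : ∀ t ∈ Icc T₁ T₂, ∀ x, ∀ h, 0 ≤ h → u t (x + h) - u t x ≤ D * h :=
    fun t ht x h hh => hu.sub_le_mul (hT.trans_le ht.1)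
      (hu.deriv_le_dataSize hν0 hf hσ hconv hD hDu (hT.trans_le ht.1)) x hh
  have hbd : ∀ t ∈ Icc T₁ T₂, ∀ x, |u t x| ≤ D := fun t ht =>
    hu.abs_le_dataSize hν0 hf hσ hconv hD hDu (hT.le.trans ht.1)
  have hlow : c₁ / ν ≤ timeAverage T₁ T₂ fun t => ∫ x in (0 : ℝ)..1, deriv (u t) x ^ 2 := by
    have h1 := hu.inv_le_dissipation hν0 hf hσ hconv hD hDu hCt fun t ht => (hsol t ht).2
    rw [timeAverage, div_le_iff₀ hν0]
    have h2 := mul_le_mul_of_nonneg_left h1 (show 0 ≤ 1 / (2 * (T₂ - T₁)) by positivity)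
    calc c₁ = 1 / (2 * (T₂ - T₁)) * (1 / (4 * D ^ 2)) := by
          rw [hc₁]
          field_simp
          norm_num
      _ ≤ _ := h2
      _ = _ := by
          rw [← hT₁, ← hT₂]
          field_simp
  have hup := hu.timeAverage_deriv_deriv_sq_le hν0 hν1 hM₁ hCt.le (fun t ht => (hsol t ht).2)
    (fun t ht => hu.abs_le_dataSize hν0 hf hσ hconv hD hDu ht.le) hT hT'
  have hsmall : ∀ ℓ ∈ dissipationRange K ν,
      c₁ / 4 * (ℓ ^ 2 / ν) ≤ structureFunction T₁ T₂ u 2 ℓ := by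
    intro ℓ hℓ
    refine hsm.le_structureFunction_two_of_small hT hT' hν0 hper hlow hup hℓ.1.le ?_
    have h1 : ℓ ^ 2 ≤ (1 / (4 * K ^ 2) * ν) ^ 2 := pow_le_pow_left₀ hℓ.1.le hℓ.2 2
    calc 4 * A * ℓ ^ 2 ≤ 4 * A * (1 / (4 * K ^ 2) * ν) ^ 2 :=
          mul_le_mul_of_nonneg_left h1 (by positivity)
      _ = A / (4 * K ^ 4) * ν ^ 2 := by
          field_simp
      _ ≤ c₁ * ν ^ 2 := by
          refine mul_le_mul_of_nonneg_right ?_ (sq_nonneg ν)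
          rw [div_le_iff₀ (by positivity)]
          linarith [show 0 < c₁ * K ^ 4 by positivity]
  have habs : ∀ ℓ, 0 ≤ ℓ → ∀ t ∈ Icc T₁ T₂, ∀ x, |u t (x + ℓ) - u t x| ≤ B / ν * ℓ :=
    fun ℓ hℓ t ht x => hu.abs_sub_le_mul (hT.trans_le ht.1) (hsol t (hT.trans_le ht.1)).1 x hℓ
  have hdiss : ∀ ℓ ∈ dissipationRange K ν,
      IncrementControl T₁ T₂ D (min (c₁ / (4 * B)) (c₃ / (2 * D))) u ℓ (B / ν * ℓ) := by
    intro ℓ hℓ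
    have hℓ0 : 0 < ℓ := hℓ.1
    refine ⟨hT, hT', hsm, hper, hℓ0, by positivity, fun t ht x => hone t ht x ℓ hℓ0.le,
      habs ℓ hℓ0.le, ?_⟩
    calc min (c₁ / (4 * B)) (c₃ / (2 * D)) * (ℓ * (B / ν * ℓ))
        ≤ c₁ / (4 * B) * (ℓ * (B / ν * ℓ)) :=
          mul_le_mul_of_nonneg_right (min_le_left _ _) (by positivity)
      _ = c₁ / 4 * (ℓ ^ 2 / ν) := by field_simp
      _ ≤ _ := hsmall ℓ hℓ
  refine ⟨hdiss, fun ℓ hℓ => ?_⟩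
  -- Half of the threshold `C₁ ν`: it lies in the dissipation range, where `S₂` is already bounded
  -- below, and `2 ℓ₀ ≤ ℓ` on the whole inertial range.
  set ℓ₀ := ν / (8 * K ^ 2) with hℓ₀
  have hℓ₀pos : 0 < ℓ₀ := by positivity
  have h2ℓ₀ : 2 * ℓ₀ = 1 / (4 * K ^ 2) * ν := by
    rw [hℓ₀]
    field_simp
    norm_num
  have hℓ₀mem : ℓ₀ ∈ dissipationRange K ν := ⟨hℓ₀pos, by linarith⟩
  have hℓ2 : 2 * ℓ₀ ≤ ℓ := h2ℓ₀.le.trans hℓ.1.le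
  have hℓ0 : 0 < ℓ := by linarith
  have hℓK : ℓ ≤ 1 / (20 * K ^ 4) := hℓ.2
  have hℓ1 : ℓ ≤ 1 := by
    refine hℓK.trans ?_
    rw [div_le_one (by positivity)]
    linarith
  have hεℓ : 2 * (D * ℓ) ≤ ε := by
    calc 2 * (D * ℓ) ≤ 2 * (D * (1 / (20 * K ^ 4))) := by gcongr
      _ ≤ ε := by
        rw [hε, le_div_iff₀ (by positivity)]
        have : 2 * (D * (1 / (20 * K ^ 4))) * (128 * D * K ^ 2) = 64 * D ^ 2 / (5 * K ^ 2) := by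
          field_simp
          norm_num
        rw [this, div_le_iff₀ (by positivity)]
        linarith [sq_nonneg D]
  have hcliff := hsm.cliff_le_structureFunction_two hT hT' hD hper hone hbd hℓ₀pos hℓ2 hℓ1 hεℓ
  have hfirst := (hdiss ℓ₀ hℓ₀mem).first_le hD
  have hsecond := hsmall ℓ₀ hℓ₀mem
  have hdiff : c₁ / (64 * K ^ 2) * ℓ₀
      ≤ structureFunction T₁ T₂ u 2 ℓ₀ - ε * structureFunction T₁ T₂ u 1 ℓ₀ := by
    have h1 := mul_le_mul_of_nonneg_left hfirst hεpos.le
    have h2 : ε * (2 * (D * ℓ₀)) = c₁ / (64 * K ^ 2) * ℓ₀ := by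
      rw [hε]
      field_simp
      norm_num
    have h3 : c₁ / 4 * (ℓ₀ ^ 2 / ν) = 2 * (c₁ / (64 * K ^ 2) * ℓ₀) := by
      rw [hℓ₀]
      field_simp
      norm_num
    linarith
  refine ⟨hT, hT', hsm, hper, hℓ0, by positivity, fun t ht x => hone t ht x ℓ hℓ0.le,
    fun t ht x => ?_, ?_⟩
  · have := abs_sub (u t (x + ℓ)) (u t x)
    linarith [hbd t ht x, hbd t ht (x + ℓ)]
  · calc min (c₁ / (4 * B)) (c₃ / (2 * D)) * (ℓ * (2 * D))
        ≤ c₃ / (2 * D) * (ℓ * (2 * D)) :=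
          mul_le_mul_of_nonneg_right (min_le_right _ _) (by positivity)
      _ = ε ^ 2 / (32 * D ^ 2) * (ℓ / ℓ₀) * (c₁ / (64 * K ^ 2) * ℓ₀) := by
          rw [hc₃]
          field_simp
      _ ≤ _ := mul_le_mul_of_nonneg_left hdiff (by positivity)
      _ ≤ _ := hcliff

/-! ### Assembly of the scaling laws and the flatness estimate -/

theorem theorem4p2 (f : ℝ → ℝ) (hf : ContDiff ℝ ∞ f) (σ : ℝ) (hσ : 0 < σ)
    (hconv : ∀ x : ℝ, σ ≤ iteratedDeriv 2 f x) (D : ℝ) (hD : 0 < D) :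
    ∃ Ct : ℝ, 0 < Ct ∧
      (∀ ν ∈ Ioc (0 : ℝ) 1, ∀ u : ℝ → ℝ → ℝ,
        IsBurgersSolution f ν u → dataSize (u 0) = D →
          ∀ t : ℝ, 0 ≤ t → sobolevNorm 1 2 (u t) ^ 2 ≤ Ct * ν⁻¹) ∧
      ∃ K : ℝ, 1 < K ∧
        (∀ p : ℝ, 0 ≤ p → ∃ C : ℝ, 0 < C ∧
          ∀ ν ∈ Ioc (0 : ℝ) (viscosityBound K), ∀ u : ℝ → ℝ → ℝ,
            IsBurgersSolution f ν u → dataSize (u 0) = D →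
              (∀ ℓ ∈ dissipationRange K ν,
                (p ≤ 1 → Comparable C
                  (structureFunction (timeOne D Ct) (timeTwo σ D Ct) u p ℓ) (ℓ ^ p)) ∧
                (1 ≤ p → Comparable C
                  (structureFunction (timeOne D Ct) (timeTwo σ D Ct) u p ℓ)
                  (ℓ ^ p * ν ^ (-(p - 1))))) ∧
              (∀ ℓ ∈ inertialRange K ν,
                (p ≤ 1 → Comparable C
                  (structureFunction (timeOne D Ct) (timeTwo σ D Ct) u p ℓ) (ℓ ^ p)) ∧
                (1 ≤ p → Comparable C
                  (structureFunction (timeOne D Ct) (timeTwo σ D Ct) u p ℓ) ℓ))) ∧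
        (∃ C : ℝ, 0 < C ∧
          ∀ ν ∈ Ioc (0 : ℝ) (viscosityBound K), ∀ u : ℝ → ℝ → ℝ,
            IsBurgersSolution f ν u → dataSize (u 0) = D →
              ∀ ℓ ∈ inertialRange K ν,
                Comparable C (flatness (timeOne D Ct) (timeTwo σ D Ct) u ℓ) ℓ⁻¹) := by
  obtain ⟨Ct, hCt, hfirst, K, B, c, hK, hB, hc, hctl⟩ := exists_incrementControl hf hσ hconv hD
  refine ⟨Ct, hCt, hfirst, K, hK, ?_⟩
  have hscaling : ∀ p : ℝ, 0 ≤ p → ∃ C : ℝ, 0 < C ∧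
      ∀ ν ∈ Ioc (0 : ℝ) (viscosityBound K), ∀ u : ℝ → ℝ → ℝ,
        IsBurgersSolution f ν u → dataSize (u 0) = D →
          (∀ ℓ ∈ dissipationRange K ν,
            (p ≤ 1 → Comparable C
              (structureFunction (timeOne D Ct) (timeTwo σ D Ct) u p ℓ) (ℓ ^ p)) ∧
            (1 ≤ p → Comparable C
              (structureFunction (timeOne D Ct) (timeTwo σ D Ct) u p ℓ)
              (ℓ ^ p * ν ^ (-(p - 1))))) ∧
          (∀ ℓ ∈ inertialRange K ν,
            (p ≤ 1 → Comparable C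
              (structureFunction (timeOne D Ct) (timeTwo σ D Ct) u p ℓ) (ℓ ^ p)) ∧
            (1 ≤ p → Comparable C
              (structureFunction (timeOne D Ct) (timeTwo σ D Ct) u p ℓ) ℓ)) := by
    intro p hp0
    obtain ⟨C, hC, hcomp⟩ := exists_comparable_structureFunction (p := p) hD hc hp0
    -- `k₁` and `k₂` are the factors by which `ℓ Λ ^ (p - 1)` differs from the stated power laws,
    -- for `Λ = B ℓ / ν` and `Λ = 2 D`. One constant `C'` serves all four cases.
    set k₁ := B ^ (p - 1) with hk₁
    set k₂ := (2 * D) ^ (p - 1) with hk₂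
    have hk₁pos : 0 < k₁ := by positivity
    have hk₂pos : 0 < k₂ := by positivity
    have hk₁inv := inv_pos.2 hk₁pos
    have hk₂inv := inv_pos.2 hk₂pos
    set C' := C * (1 + (k₁ + k₁⁻¹) + (k₂ + k₂⁻¹)) with hC'
    have hC0 : C ≤ C' := le_mul_of_one_le_right hC.le (by linarith)
    have hC1 : C * (k₁ + k₁⁻¹) ≤ C' := mul_le_mul_of_nonneg_left (by linarith) hC.le
    have hC2 : C * (k₂ + k₂⁻¹) ≤ C' := mul_le_mul_of_nonneg_left (by linarith) hC.le
    refine ⟨C', by positivity, fun ν hν u hu hDu => ?_⟩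
    obtain ⟨hdiss, hiner⟩ := hctl ν hν u hu hDu
    refine ⟨fun ℓ hℓ => ⟨fun hp => ?_, fun hp => ?_⟩, fun ℓ hℓ => ⟨fun hp => ?_, fun hp => ?_⟩⟩
    · have hℓ0 := (hdiss ℓ hℓ).scale_pos
      exact ((hcomp (hdiss ℓ hℓ)).1 hp).mono hC hC0 (by positivity)
    · have hℓ0 := (hdiss ℓ hℓ).scale_pos
      have hν0 := hν.1
      have h := (hcomp (hdiss ℓ hℓ)).2 hp
      have e : ℓ * (B / ν * ℓ) ^ (p - 1) = k₁ * (ℓ ^ p * ν ^ (-(p - 1))) := by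
        have h1 : ℓ ^ p = ℓ ^ (p - 1) * ℓ := by
          rw [← Real.rpow_add_one hℓ0.ne', sub_add_cancel]
        rw [Real.mul_rpow (by positivity) hℓ0.le, Real.div_rpow hB.le hν0.le,
          Real.rpow_neg hν0.le, h1]
        ring
      rw [e] at h
      exact (h.of_mul hC hk₁pos (by positivity)).mono (by positivity) hC1 (by positivity)
    · have hℓ0 := (hiner ℓ hℓ).scale_pos
      exact ((hcomp (hiner ℓ hℓ)).1 hp).mono hC hC0 (by positivity)
    · have hℓ0 := (hiner ℓ hℓ).scale_pos
      have h := (hcomp (hiner ℓ hℓ)).2 hp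
      rw [mul_comm ℓ] at h
      exact (h.of_mul hC hk₂pos hℓ0.le).mono (by positivity) hC2 hℓ0.le
  refine ⟨hscaling, ?_⟩
  obtain ⟨C₂, hC₂, h₂⟩ := hscaling 2 zero_le_two
  obtain ⟨C₄, hC₄, h₄⟩ := hscaling 4 (by norm_num)
  refine ⟨C₄ * C₂ ^ 2, by positivity, fun ν hν u hu hDu ℓ hℓ => ?_⟩
  exact comparable_flatness ((hctl ν hν u hu hDu).2 ℓ hℓ).scale_pos hC₂ hC₄
    (((h₂ ν hν u hu hDu).2 ℓ hℓ).2 one_le_two) (((h₄ ν hν u hu hDu).2 ℓ hℓ).2 (by norm_num))
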